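/- Let $d\ge 1$, $0<s<1$, $p\ge 2$ and $\alpha,\beta,\alpha+\beta\in(-sp,d)$. Put $$\mathcal C=\int_0^1 r^{sp-1}\left(r^{\alpha}+r^{\beta}\right)\left|1-r^{\frac{d-\alpha-\beta-sp}{p}}\right|^p\Phi(r)\,dr,$$ where, for $0<r<1$, $$\Phi(r)=|\mathbb S^{d-2}|\int_{-1}^1\frac{(1-t^2)^{\frac{d-3}{2}}}{(1-2tr+r^2)^{\frac{d+sp}{2}}}\,dt\quad(d\ge2),\qquad \Phi(r)=(1-r)^{-1-sp}+(1+r)^{-1-sp}\quad(d=1),$$ with $|\mathbb S^{d-2}|$ the surface measure of the unit sphere in $\mathbb R^{d-1}$ (so $|\mathbb S^0|=2$), and $$c_p=\min_{0<\tau<\frac12}\left((1-\tau)^p-\tau^p+p\tau^{p-1}\right).$$ The integral defining $\mathcal C$ converges and the minimum defining $c_p$ is attained. Let $u$ be a real- or complex-valued function such that either $sp+\alpha+\beta<d$ and $u\in C_c(\mathbb R^d)$, or $sp+\alpha+\beta>d$ and $u\in C_c(\mathbb R^d\setminus\{0\})$ (extended by $0$ to the origin). Put $v(x)=|x|^{\frac{d-\alpha-\beta-sp}{p}}u(x)$.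 Then $\int_{\mathbb R^d}|u(x)|^p|x|^{-sp-\alpha-\beta}\,dx<\infty$ and $$\int_{\mathbb R^d}\int_{\mathbb R^d}\frac{|u(x)-u(y)|^p}{|x-y|^{d+sp}}|x|^{-\alpha}|y|^{-\beta}\,dy\,dx-\mathcal C\int_{\mathbb R^d}\frac{|u(x)|^p}{|x|^{sp+\alpha+\beta}}\,dx\ \ge\ c_p\int_{\mathbb R^d}\int_{\mathbb R^d}\frac{|v(x)-v(y)|^p}{|x-y|^{d+sp}}|x|^{-\frac{d+\alpha-\beta-sp}{2}}|y|^{-\frac{d-\alpha+\beta-sp}{2}}\,dy\,dx,$$ where the double integrals take values in $[0,\infty]$. For $p=2$ one has $c_2=1$ and the inequality is an equality in $[0,\infty]$. -/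

import Mathlib

open MeasureTheory Set

/-- The weighted Gagliardo energy
`∫∫ |f x - f y| ^ p / |x - y| ^ (d + s p) * |x| ^ (-a) * |y| ^ (-b) dy dx` over `ℝᵈ × ℝᵈ`,
with values in `[0, ∞]`. -/
noncomputable def weightedGagliardo {𝕜 : Type*} [RCLike 𝕜] (d : ℕ) (s p a b : ℝ)
    (f : EuclideanSpace ℝ (Fin d) → 𝕜) : ENNReal :=
  ∫⁻ x : EuclideanSpace ℝ (Fin d), ∫⁻ y : EuclideanSpace ℝ (Fin d),
    ENNReal.ofReal (‖f x - f y‖ ^ p / ‖x - y‖ ^ ((d : ℝ) + s * p) * ‖x‖ ^ (-a) * ‖y‖ ^ (-b))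

/-- The Hardy term `∫ |f x| ^ p / |x| ^ a dx` over `ℝᵈ`, with values in `[0, ∞]`. -/
noncomputable def hardyTerm {𝕜 : Type*} [RCLike 𝕜] (d : ℕ) (p a : ℝ)
    (f : EuclideanSpace ℝ (Fin d) → 𝕜) : ENNReal :=
  ∫⁻ x : EuclideanSpace ℝ (Fin d), ENNReal.ofReal (‖f x‖ ^ p / ‖x‖ ^ a)

/-- The surface measure `|𝕊ⁿ⁻¹|` of the unit sphere of `ℝⁿ` (it is `2` for `n = 1`). -/
noncomputable def sphereArea (n : ℕ) : ℝ :=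
  (volume : Measure (EuclideanSpace ℝ (Fin n))).toSphere.real univ

/-- The function `Φ_{d,s,p}` on `(0, 1)`, for `d ≥ 1`. -/
noncomputable def hardyPhi (d : ℕ) (s p r : ℝ) : ℝ :=
  if d = 1 then (1 - r) ^ (-1 - s * p) + (1 + r) ^ (-1 - s * p)
  else sphereArea (d - 1) *
    ∫ t in Ioo (-1 : ℝ) 1,
      (1 - t ^ 2) ^ (((d : ℝ) - 3) / 2) / (1 - 2 * t * r + r ^ 2) ^ (((d : ℝ) + s * p) / 2)

/-- The integrand of the constant `𝒞(d,s,p,α,β)`. -/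
noncomputable def hardyIntegrand (d : ℕ) (s p α β r : ℝ) : ℝ :=
  r ^ (s * p - 1) * (r ^ α + r ^ β) * |1 - r ^ (((d : ℝ) - α - β - s * p) / p)| ^ p *
    hardyPhi d s p r

/-- The constant `𝒞(d,s,p,α,β)`. -/
noncomputable def hardyConst (d : ℕ) (s p α β : ℝ) : ℝ :=
  ∫ r in Ioo (0 : ℝ) 1, hardyIntegrand d s p α β r

/-- The set of values over which the constant `c_p` is the minimum. -/
def remainderValues (p : ℝ) : Set ℝ :=
  (fun τ : ℝ => (1 - τ) ^ p - τ ^ p + p * τ ^ (p - 1)) '' Ioo (0 : ℝ) (1 / 2)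

/-- The constant `c_p = min_{0 < τ < 1/2} ((1 - τ) ^ p - τ ^ p + p τ ^ (p - 1))`. -/
noncomputable def remainderConst (p : ℝ) : ℝ := sInf (remainderValues p)

/-- The function `v(x) = |x| ^ ((d - α - β - s p) / p) u(x)`. -/
noncomputable def groundStateQuotient {𝕜 : Type*} [RCLike 𝕜] (d : ℕ) (s p α β : ℝ)
    (u : EuclideanSpace ℝ (Fin d) → 𝕜) : EuclideanSpace ℝ (Fin d) → 𝕜 :=
  fun x => ‖x‖ ^ (((d : ℝ) - α - β - s * p) / p) • u x

/-! The proof is a ground state representation. Put γ = (d - α - β - sp)/p and w(x) = |x|^(-γ), so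
that u = w v away from the origin. For weights w₁ > w₂ > 0, `ground_state_le` bounds |w₁v₁ - w₂v₂|^p
below by (w₁ - w₂)^(p-1) (w₁|v₁|^p - w₂|v₂|^p) + c_p (w₁w₂)^(p/2) |v₁ - v₂|^p, with equality for p =
2. Multiplied by the symmetrized kernel and integrated, the linear terms should give the Hardy term
and the last one the remainder.

The pointwise bound is a quantitative Jensen inequality (`jensen_gap_le`) on the segment from (w₁ -
w₂)v₂ to w₁v₁ - w₂v₂, which contains (w₁ - w₂)v₁. The Jensen gap is obtained by integrating Bregman
distances of |·|^p to one endpoint. Each of them is at least c_p times a p-th power (`bregman_le`),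
and the resulting integral is bounded below by comparing logarithmic and geometric means.

The two linear terms cannot be integrated separately over all pairs, since either integral may
diverge near |x| = |y|. They are therefore integrated over |y| < θ|x| with θ < 1. By scaling each is
a coefficient times the Hardy integral, and the two coefficients differ by the integral of
`hardyIntegrand` over (0, θ) (`outerCoeff_eq`, `innerCoeff_eq`). The smaller coefficient is finite
and cancels (`cut_inequality`); monotone convergence as θ → 1 finishes the proof, including the case
of infinite energy. -/

/-! ### The constant c_p. -/

/-- The function whose minimum over `(0, 1 / 2)` is `remainderConst p`. -/
noncomputable def remainderFun (p τ : ℝ) : ℝ := (1 - τ) ^ p - τ ^ p + p * τ ^ (p - 1)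

lemma continuous_remainderFun {p : ℝ} (hp : 2 ≤ p) : Continuous (remainderFun p) := by
  unfold remainderFun
  refine ((Continuous.rpow_const (by fun_prop) fun _ => Or.inr (by linarith)).sub
    (Continuous.rpow_const (by fun_prop) fun _ => Or.inr (by linarith))).add
    (continuous_const.mul (Continuous.rpow_const (by fun_prop) fun _ => Or.inr (by linarith)))

lemma hasDerivAt_remainderFun {p : ℝ} (hp : 2 ≤ p) (τ : ℝ) :
    HasDerivAt (remainderFun p)
      (-(p * (1 - τ) ^ (p - 1)) - p * τ ^ (p - 1) + p * ((p - 1) * τ ^ (p - 2))) τ := by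
  have h1 : HasDerivAt (fun τ : ℝ => (1 - τ) ^ p) (-1 * p * (1 - τ) ^ (p - 1)) τ :=
    ((hasDerivAt_id τ).const_sub 1).rpow_const (Or.inr (by linarith))
  have h2 : HasDerivAt (fun τ : ℝ => τ ^ p) (1 * p * τ ^ (p - 1)) τ :=
    (hasDerivAt_id τ).rpow_const (Or.inr (by linarith))
  have h3 : HasDerivAt (fun τ : ℝ => τ ^ (p - 1)) (1 * (p - 1) * τ ^ (p - 1 - 1)) τ :=
    (hasDerivAt_id τ).rpow_const (Or.inr (by linarith))
  have h := (h1.sub h2).add (h3.const_mul p)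
  have e : p - 1 - 1 = p - 2 := by ring
  rw [e] at h
  exact h.congr_deriv (by ring)

lemma remainderFun_nonneg {p τ : ℝ} (hp : 2 ≤ p) (h0 : 0 ≤ τ) (h1 : τ ≤ 1 / 2) :
    0 ≤ remainderFun p τ := by
  have h : τ ^ p ≤ (1 - τ) ^ p := Real.rpow_le_rpow h0 (by linarith) (by linarith)
  have : 0 ≤ p * τ ^ (p - 1) := by positivity
  unfold remainderFun
  linarith

lemma remainderFun_two (τ : ℝ) : remainderFun 2 τ = 1 := by
  unfold remainderFun
  rw [Real.rpow_two, Real.rpow_two, show (2 : ℝ) - 1 = 1 by norm_num, Real.rpow_one]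
  ring

lemma remainderValues_eq (p : ℝ) : remainderValues p = remainderFun p '' Ioo 0 (1 / 2) := rfl

/-- The derivative of a function at the left end of an interval is nonnegative at a minimum. -/
lemma deriv_nonneg_of_isMinOn_left {f : ℝ → ℝ} {a b f' : ℝ} (hab : a < b)
    (h : HasDerivAt f f' a) (hm : ∀ x ∈ Icc a b, f a ≤ f x) : 0 ≤ f' := by
  have h' := h.hasDerivWithinAt (s := Ioi a)
  rw [hasDerivWithinAt_iff_tendsto_slope' (by simp)] at h'
  refine ge_of_tendsto h' ?_
  filter_upwards [Ioo_mem_nhdsGT hab] with x hx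
  rw [slope_def_field]
  exact div_nonneg (by linarith [hm x ⟨hx.1.le, hx.2.le⟩]) (by linarith [hx.1])

lemma deriv_nonpos_of_isMinOn_right {f : ℝ → ℝ} {a b f' : ℝ} (hab : a < b)
    (h : HasDerivAt f f' b) (hm : ∀ x ∈ Icc a b, f b ≤ f x) : f' ≤ 0 := by
  have h' := h.hasDerivWithinAt (s := Iio b)
  rw [hasDerivWithinAt_iff_tendsto_slope' (by simp)] at h'
  refine le_of_tendsto h' ?_
  filter_upwards [Ioo_mem_nhdsLT hab] with x hx
  rw [slope_def_field]
  exact div_nonpos_of_nonneg_of_nonpos (by linarith [hm x ⟨hx.1.le, hx.2.le⟩]) (by linarith [hx.2])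

/-- Compactness gives a minimizer on the closed interval. For p > 2 the slope is -p < 0 at 0 and p(p
- 2)2^(2-p) > 0 at 1/2, so the minimizer is interior. For p = 2 the function is constant and any
interior point serves. -/
lemma exists_isLeast_remainderValues {p : ℝ} (hp : 2 ≤ p) :
    ∃ c, IsLeast (remainderValues p) c := by
  rw [remainderValues_eq]
  rcases hp.eq_or_lt with rfl | hp2
  · refine ⟨1, ⟨1 / 4, by norm_num, remainderFun_two _⟩, ?_⟩
    rintro _ ⟨τ, -, rfl⟩
    rw [remainderFun_two]
  · obtain ⟨τ, hτ, hmin⟩ := isCompact_Icc.exists_isMinOn (s := Icc (0 : ℝ) (1 / 2))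
      (by simp) (continuous_remainderFun hp).continuousOn
    have hmin' : ∀ x ∈ Icc (0 : ℝ) (1 / 2), remainderFun p τ ≤ remainderFun p x := hmin
    have h0 : τ ≠ 0 := by
      rintro rfl
      have := deriv_nonneg_of_isMinOn_left (by norm_num) (hasDerivAt_remainderFun hp 0) hmin'
      rw [Real.zero_rpow (by linarith), Real.zero_rpow (by linarith), sub_zero,
        Real.one_rpow] at this
      linarith
    have h1 : τ ≠ 1 / 2 := by
      rintro rfl
      have := deriv_nonpos_of_isMinOn_right (by norm_num) (hasDerivAt_remainderFun hp (1 / 2)) hmin'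
      have e : ((1 : ℝ) / 2) ^ (p - 1) = (1 / 2) ^ (p - 2) * (1 / 2) := by
        rw [show p - 1 = p - 2 + 1 by ring, Real.rpow_add_one (by norm_num)]
      rw [show (1 : ℝ) - 1 / 2 = 1 / 2 by norm_num, e] at this
      have hpos : 0 < ((1 : ℝ) / 2) ^ (p - 2) := by positivity
      have : p * (p - 2) * ((1 : ℝ) / 2) ^ (p - 2) ≤ 0 := by linarith
      have : 0 < p * (p - 2) * ((1 : ℝ) / 2) ^ (p - 2) :=
        mul_pos (mul_pos (by linarith) (by linarith)) hpos
      linarith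
    refine ⟨remainderFun p τ, ⟨τ, ⟨hτ.1.lt_of_ne' h0, hτ.2.lt_of_ne h1⟩, rfl⟩, ?_⟩
    rintro _ ⟨x, hx, rfl⟩
    exact hmin' x ⟨hx.1.le, hx.2.le⟩

lemma isLeast_remainderConst {p : ℝ} (hp : 2 ≤ p) :
    IsLeast (remainderValues p) (remainderConst p) := by
  obtain ⟨c, hc⟩ := exists_isLeast_remainderValues hp
  rw [remainderConst, hc.csInf_eq]
  exact hc

lemma remainderConst_two : remainderConst 2 = 1 := by
  obtain ⟨τ, -, h⟩ := (isLeast_remainderConst le_rfl).1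
  exact h.symm.trans (remainderFun_two τ)

lemma remainderConst_nonneg {p : ℝ} (hp : 2 ≤ p) : 0 ≤ remainderConst p := by
  obtain ⟨τ, hτ, h⟩ := (isLeast_remainderConst hp).1
  rw [← h]
  exact remainderFun_nonneg hp hτ.1.le hτ.2.le

/-- The bound passes to the closure by continuity. Both endpoints occur in `bregman_le`: τ = 1/2 in
one regime, τ = 0 when A = 0. -/
lemma remainderConst_le {p τ : ℝ} (hp : 2 ≤ p) (hτ : τ ∈ Icc (0 : ℝ) (1 / 2)) :
    remainderConst p ≤ remainderFun p τ := by
  have h : Ioo (0 : ℝ) (1 / 2) ⊆ {x | remainderConst p ≤ remainderFun p x} := fun x hx =>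
    (isLeast_remainderConst hp).2 ⟨x, hx, rfl⟩
  have hcl : IsClosed {x | remainderConst p ≤ remainderFun p x} :=
    isClosed_le continuous_const (continuous_remainderFun hp)
  have := closure_minimal h hcl
  rw [closure_Ioo (by norm_num)] at this
  exact this hτ

/-! ### Scalar convexity inequalities behind the pointwise bound. -/

/-- The tangent line inequality for `s ↦ s ^ m`. -/
lemma rpow_tangent_le {m s a : ℝ} (hm : 1 ≤ m) (hs : 0 ≤ s) (ha : 0 ≤ a) :
    a ^ m + m * a ^ (m - 1) * (s - a) ≤ s ^ m := by
  rcases ha.eq_or_lt with rfl | ha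
  · rw [Real.zero_rpow (by linarith)]
    rcases hm.eq_or_lt with rfl | hm
    · simp
    · rw [Real.zero_rpow (by linarith)]
      simpa using Real.rpow_nonneg hs m
  · have h := one_add_mul_self_le_rpow_one_add (s := s / a - 1)
      (by have : 0 ≤ s / a := by positivity
          linarith) hm
    rw [show 1 + (s / a - 1) = s / a by ring, Real.div_rpow hs ha.le,
      le_div_iff₀ (by positivity)] at h
    refine le_trans (le_of_eq ?_) h
    rw [Real.rpow_sub_one ha.ne']
    field_simp

/-- The Bregman distance of `‖·‖ ^ p` dominates `c_p` times the `p`-th power of the distance. -/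
lemma bregman_le {p A B R : ℝ} (hp : 2 ≤ p) (hA : 0 ≤ A) (hR : 0 ≤ R) (hB : B ^ 2 ≤ A * R) :
    A ^ (p / 2) + p * A ^ (p / 2 - 1) * B + remainderConst p * R ^ (p / 2)
      ≤ (A + 2 * B + R) ^ (p / 2) := by
  obtain ⟨a, ha, rfl⟩ : ∃ a, 0 ≤ a ∧ A = a ^ 2 := ⟨√A, by positivity, (Real.sq_sqrt hA).symm⟩
  obtain ⟨r, hr, rfl⟩ : ∃ r, 0 ≤ r ∧ R = r ^ 2 := ⟨√R, by positivity, (Real.sq_sqrt hR).symm⟩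
  have hB' : |B| ≤ a * r := abs_le_of_sq_le_sq (by rw [mul_pow]; exact hB) (by positivity)
  have hB1 := (abs_le.1 hB').1
  have hs : 0 ≤ a ^ 2 + 2 * B + r ^ 2 := by nlinarith [sq_nonneg (a - r)]
  have hpow : ∀ x : ℝ, 0 ≤ x → ∀ q : ℝ, (x ^ 2) ^ (q / 2) = x ^ q := fun x hx q => by
    rw [← Real.rpow_natCast, ← Real.rpow_mul hx]
    congr 1
    push_cast
    ring
  have hr1 : r ^ p = r ^ (p - 2) * r ^ 2 := by
    rw [← Real.rpow_natCast, ← Real.rpow_add' hr (by push_cast; linarith)]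
    congr 1
    push_cast
    ring
  have em : p / 2 - 1 = (p - 2) / 2 := by ring
  rw [em, hpow a ha, hpow a ha, hpow r hr]
  -- Here a = |X|, r = |Y|, B = Re⟨X, Y⟩, and s = |X + Y|². Both regimes use a tangent line of s ↦
  -- s^(p/2), at different points.
  rcases le_or_gt r (2 * a) with h | h
  -- The tangent at s = a² reproduces the terms linear in B exactly and leaves (p/2) a^(p-2) r².
  -- Since a ≥ r/2, this is at least the value at τ = 1/2 times r^p.
  · have ht := rpow_tangent_le (m := p / 2) (by linarith) hs (sq_nonneg a)
    rw [em, hpow a ha, hpow a ha] at ht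
    have hc := remainderConst_le hp (τ := 1 / 2) (by norm_num)
    have e : remainderFun p (1 / 2) * r ^ p = p / 2 * (r / 2) ^ (p - 2) * r ^ 2 := by
      unfold remainderFun
      rw [show (1 : ℝ) - 1 / 2 = 1 / 2 by norm_num, Real.div_rpow hr (by norm_num),
        show p - 1 = p - 2 + 1 by ring, Real.rpow_add_one (by norm_num), hr1,
        Real.div_rpow (by norm_num) (by norm_num) (p - 2), Real.one_rpow]
      ring
    have h2 : (r / 2) ^ (p - 2) ≤ a ^ (p - 2) :=
      Real.rpow_le_rpow (by positivity) (by linarith) (by linarith)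
    have h3 := mul_le_mul_of_nonneg_right hc (Real.rpow_nonneg hr p)
    have h4 : p / 2 * (r / 2) ^ (p - 2) * r ^ 2 ≤ p / 2 * a ^ (p - 2) * r ^ 2 := by gcongr
    linarith
  · have hr0 : 0 < r := by linarith
    -- The value s = (r - a)² is attained at the extreme B = -ar. The slope there dominates p
    -- a^(p-2), so this B is the worst case, and in it the claim is the definition of c_p with τ =
    -- a/r < 1/2.
    have ht := rpow_tangent_le (m := p / 2) (by linarith) hs (sq_nonneg (r - a))
    rw [em, hpow _ (by linarith), hpow _ (by linarith)] at ht
    have hc := remainderConst_le hp (τ := a / r)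
      ⟨by positivity, by rw [div_le_div_iff₀ hr0 (by norm_num)]; linarith⟩
    have e : remainderFun p (a / r) * r ^ p = (r - a) ^ p - a ^ p + p * a ^ (p - 2) * (a * r) := by
      unfold remainderFun
      have e1 : 1 - a / r = (r - a) / r := by field_simp
      have e2 : a ^ (p - 1) = a ^ (p - 2) * a := by
        nth_rewrite 3 [← Real.rpow_one a]
        rw [← Real.rpow_add' ha (by linarith)]
        congr 1
        ring
      have e3 : r ^ (p - 1) * r = r ^ p := by
        rw [← Real.rpow_add_one hr0.ne']
        congr 1
        ring
      rw [e1, Real.div_rpow (by linarith) hr, Real.div_rpow ha hr, Real.div_rpow ha hr, e2, ← e3]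
      have : 0 < r ^ (p - 1) := by positivity
      field_simp
    have h2 : a ^ (p - 2) ≤ (r - a) ^ (p - 2) := Real.rpow_le_rpow ha (by linarith) (by linarith)
    have h3 := mul_le_mul_of_nonneg_right hc (Real.rpow_nonneg hr p)
    have h4 : p * a ^ (p - 2) * (B + a * r) ≤ p * (r - a) ^ (p - 2) * (B + a * r) :=
      mul_le_mul_of_nonneg_right (by gcongr) (by linarith)
    have e5 : p / 2 * (r - a) ^ (p - 2) * (a ^ 2 + 2 * B + r ^ 2 - (r - a) ^ 2)
        = p * (r - a) ^ (p - 2) * (B + a * r) := by ring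
    linarith

/-- The logarithmic mean dominates the geometric mean, for the points `1` and `t ^ (p - 1)`. -/
lemma one_sub_mul_rpow_le {p t : ℝ} (hp : 2 ≤ p) (h0 : 0 < t) (h1 : t ≤ 1) :
    (1 - t) * t ^ (p / 2 - 1) ≤ (1 - t ^ (p - 1)) / (p - 1) := by
  have hp1 : 0 < p - 1 := by linarith
  -- Division by t^q makes the inequality symmetric: with t = e^(-2x) it reads sinh((p - 1)x) ≥ (p -
  -- 1) sinh x for x ≥ 0. The difference is shown to be antitone in t and vanishes at t = 1.
  set q := (p - 1) / 2 with hq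
  have hmono : AntitoneOn (fun t : ℝ => t ^ (-q) - t ^ q - (p - 1) * (t ^ (-(1/2) : ℝ) - t ^ (1/2 : ℝ)))
      (Ioc 0 1) := by
    refine antitoneOn_of_deriv_nonpos (convex_Ioc 0 1) ?_ ?_ ?_
    · intro x hx
      refine ContinuousAt.continuousWithinAt ?_
      have := hx.1.ne'
      fun_prop (disch := exact Or.inl this)
    · intro x hx
      rw [interior_Ioc] at hx
      have := hx.1.ne'
      refine DifferentiableAt.differentiableWithinAt ?_
      fun_prop (disch := exact this)
    · intro x hx
      rw [interior_Ioc] at hx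
      have hx0 := hx.1
      have hd : HasDerivAt (fun t : ℝ => t ^ (-q) - t ^ q - (p - 1) * (t ^ (-(1/2) : ℝ) - t ^ (1/2 : ℝ)))
          ((-q) * x ^ (-q - 1) - q * x ^ (q - 1) -
            (p - 1) * ((-(1/2)) * x ^ (-(1/2) - 1 : ℝ) - (1/2) * x ^ (1/2 - 1 : ℝ))) x :=
        ((Real.hasDerivAt_rpow_const (Or.inl hx0.ne')).sub
          (Real.hasDerivAt_rpow_const (Or.inl hx0.ne'))).sub
          (((Real.hasDerivAt_rpow_const (Or.inl hx0.ne')).sub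
          (Real.hasDerivAt_rpow_const (Or.inl hx0.ne'))).const_mul _)
      rw [hd.deriv]
      simp only [Real.rpow_sub_one hx0.ne', Real.rpow_neg hx0.le]
      have hle : x ^ q ≤ x ^ (1/2 : ℝ) :=
        Real.rpow_le_rpow_of_exponent_ge hx0 hx.2.le (by rw [hq]; linarith)
      have hY1 : x ^ (1/2 : ℝ) ≤ 1 := Real.rpow_le_one hx0.le hx.2.le (by norm_num)
      have hX : 0 < x ^ q := by positivity
      have hY : 0 < x ^ (1/2 : ℝ) := by positivity
      generalize x ^ q = X at *
      generalize x ^ (1/2 : ℝ) = Y at *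
      -- Monotonicity of cosh, in the form that X ↦ X + 1/X decreases on (0, 1].
      have hXY : Y + Y⁻¹ ≤ X + X⁻¹ := by
        rw [← sub_nonneg]
        have : X + X⁻¹ - (Y + Y⁻¹) = (Y - X) * (1 - X * Y) / (X * Y) := by
          field_simp
          ring
        rw [this]
        refine div_nonneg (mul_nonneg (by linarith) ?_) (by positivity)
        nlinarith
      have e : -q * (X⁻¹ / x) - q * (X / x) - (p - 1) * (-(1 / 2) * (Y⁻¹ / x) - 1 / 2 * (Y / x))
          = -(q / x * ((X + X⁻¹) - (Y + Y⁻¹))) := by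
        rw [show p - 1 = 2 * q by rw [hq]; ring]
        ring
      rw [e, neg_nonpos]
      exact mul_nonneg (by positivity) (by linarith)
  have h := hmono ⟨h0, h1⟩ (right_mem_Ioc.2 one_pos) h1
  simp only [Real.one_rpow, sub_self, mul_zero] at h
  rw [le_div_iff₀ hp1]
  have hm := mul_le_mul_of_nonneg_right h (Real.rpow_nonneg h0.le q)
  have e : (t ^ (-q) - t ^ q - (p - 1) * (t ^ (-(1/2) : ℝ) - t ^ (1/2 : ℝ))) * t ^ q
      = t ^ (-q) * t ^ q - t ^ q * t ^ q
        - (p - 1) * (t ^ (-(1/2) : ℝ) * t ^ q - t ^ (1/2 : ℝ) * t ^ q) := by ring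
  rw [zero_mul, e, ← Real.rpow_add h0, ← Real.rpow_add h0, ← Real.rpow_add h0,
    ← Real.rpow_add h0] at hm
  rw [show -q + q = 0 by ring, show q + q = p - 1 by rw [hq]; ring,
    show -(1 / 2) + q = p / 2 - 1 by rw [hq]; ring,
    show 1 / 2 + q = p / 2 - 1 + 1 by rw [hq]; ring, Real.rpow_zero, Real.rpow_add_one h0.ne'] at hm
  linarith

/-- A quantitative Jensen inequality for the `p / 2`-th power of a nonnegative quadratic. -/
lemma jensen_gap_le {p P Q R δ : ℝ} (hp : 2 ≤ p) (hR : 0 ≤ R) (hδ0 : 0 ≤ δ) (hδ1 : δ < 1)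
    (hN : ∀ x, 0 ≤ (1 - x) * P + x * Q - x * (1 - x) * R) :
    ((1 - δ) * P + δ * Q - δ * (1 - δ) * R) ^ (p / 2)
        + remainderConst p * (δ * (1 - δ) ^ (p / 2) * R ^ (p / 2))
      ≤ (1 - δ) * P ^ (p / 2) + δ * Q ^ (p / 2) := by
  set c := remainderConst p with hc
  have hc0 : 0 ≤ c := remainderConst_nonneg hp
  set N : ℝ → ℝ := fun x => (1 - x) * P + x * Q - x * (1 - x) * R with hNdef
  set m := p / 2 with hm
  have hm1 : 1 ≤ m := by rw [hm]; linarith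
  set D : ℝ → ℝ := fun x => Q - P - (1 - 2 * x) * R with hD
  have hNd : ∀ x, HasDerivAt N (D x) x := fun x => by
    have h1 := ((hasDerivAt_id x).const_sub 1).mul_const P
    have h2 := (hasDerivAt_id x).mul_const Q
    have h3 := ((hasDerivAt_id x).mul ((hasDerivAt_id x).const_sub 1)).mul_const R
    refine ((h1.add h2).sub h3).congr_deriv ?_
    simp [hD]
    ring
  -- `N x` plays the role of the squared norm of the point at parameter x on the segment, and `g` is
  -- the Jensen gap there.
  set g : ℝ → ℝ := fun x => (1 - x) * P ^ m + x * Q ^ m - N x ^ m with hg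
  have hgd : ∀ x, HasDerivAt g (Q ^ m - P ^ m - D x * m * N x ^ (m - 1)) x := fun x => by
    have h1 := ((hasDerivAt_id x).const_sub 1).mul_const (P ^ m)
    have h2 := (hasDerivAt_id x).mul_const (Q ^ m)
    have h3 := (hNd x).rpow_const (p := m) (Or.inr hm1)
    refine ((h1.add h2).sub h3).congr_deriv ?_
    simp
    ring
  -- The combination g + (1 - x)g' equals Q^m - N^m - (1 - x)(N^m)', the Bregman distance from the
  -- point at x to the endpoint at 1; their squared distance is (1 - x)²R.
  have hbr : ∀ x ∈ Icc (0 : ℝ) 1, c * ((1 - x) ^ p * R ^ m) ≤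
      g x + (1 - x) * (Q ^ m - P ^ m - D x * m * N x ^ (m - 1)) := fun x hx => by
    -- The quadratic in y below is N(x + y), nonnegative for every real y. Its discriminant supplies
    -- the Cauchy-Schwarz bound needed by `bregman_le`.
    have hdisc : D x ^ 2 ≤ 4 * N x * R := by
      have : ∀ y, 0 ≤ R * (y * y) + D x * y + N x := fun y => by
        have := hN (x + y)
        simp only [hNdef, hD]
        nlinarith
      have := discrim_le_zero this
      unfold discrim at this
      linarith
    have hx1 : 0 ≤ 1 - x := by linarith [hx.2]
    have h := bregman_le (p := p) (A := N x) (B := D x * (1 - x) / 2) (R := (1 - x) ^ 2 * R) hp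
      (hN x) (by positivity) (by nlinarith [sq_nonneg (1 - x)])
    rw [← hm, ← hc, Real.mul_rpow (by positivity) hR, ← Real.rpow_natCast, ← Real.rpow_mul hx1,
      show ((2 : ℕ) : ℝ) * m = p by rw [hm]; push_cast; ring] at h
    have e : N x + 2 * (D x * (1 - x) / 2) + (1 - x) ^ ((2 : ℕ) : ℝ) * R = Q := by
      simp only [hNdef, hD, Real.rpow_natCast]
      ring
    rw [e] at h
    have e2 : p * N x ^ (m - 1) * (D x * (1 - x) / 2) = m * N x ^ (m - 1) * D x * (1 - x) := by
      rw [hm]; ring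
    rw [e2] at h
    simp only [hg]
    linarith
  -- The derivative of g/(1 - x) is (g + (1 - x)g')/(1 - x)², hence at least c R^m (1 - x)^(p-2).
  -- The subtracted term is the primitive of this lower bound vanishing at 0.
  have hmono : MonotoneOn
      (fun x => g x / (1 - x) - c * R ^ m * ((1 - (1 - x) ^ (p - 1)) / (p - 1))) (Ico 0 1) := by
    have hd : ∀ x ∈ Ico (0 : ℝ) 1, HasDerivAt
        (fun x => g x / (1 - x) - c * R ^ m * ((1 - (1 - x) ^ (p - 1)) / (p - 1)))
        (((Q ^ m - P ^ m - D x * m * N x ^ (m - 1)) * (1 - x) - g x * (-1)) / (1 - x) ^ 2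
          - c * R ^ m * (-(-1 * (p - 1) * (1 - x) ^ (p - 1 - 1)) / (p - 1))) x := fun x hx => by
      have h1 := (hasDerivAt_id x).const_sub 1
      exact ((hgd x).div h1 (by simp; linarith [hx.2])).sub
        ((((h1.rpow_const (Or.inr (by linarith))).const_sub 1).div_const _).const_mul _)
    refine monotoneOn_of_deriv_nonneg (convex_Ico 0 1) ?_ ?_ ?_
    · exact fun x hx => (hd x hx).continuousAt.continuousWithinAt
    · intro x hx
      rw [interior_Ico] at hx
      exact (hd x ⟨hx.1.le, hx.2⟩).differentiableAt.differentiableWithinAt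
    · intro x hx
      rw [interior_Ico] at hx
      rw [(hd x ⟨hx.1.le, hx.2⟩).deriv]
      have hx1 : 0 < 1 - x := by linarith [hx.2]
      have h := hbr x ⟨hx.1.le, hx.2.le⟩
      have hp1 : p - 1 ≠ 0 := by linarith
      have e : (1 - x) ^ p = (1 - x) ^ (p - 1 - 1) * (1 - x) ^ 2 := by
        rw [← Real.rpow_natCast, ← Real.rpow_add hx1]
        congr 1
        push_cast
        ring
      rw [e] at h
      have e2 : -(-1 * (p - 1) * (1 - x) ^ (p - 1 - 1)) / (p - 1) = (1 - x) ^ (p - 1 - 1) := by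
        field_simp
      rw [e2, sub_nonneg, le_div_iff₀ (by positivity)]
      linarith
  have h := hmono (left_mem_Ico.2 one_pos) ⟨hδ0, hδ1⟩ hδ0
  have hg0 : g 0 = 0 := by simp [hg, hNdef]
  simp only [hg0, sub_zero, Real.one_rpow, sub_self, zero_div, mul_zero] at h
  have ht : 0 < 1 - δ := by linarith
  -- Applied with t = 1 - δ, this replaces the integrated constant by one symmetric in the weights,
  -- which produces the factor (w₁w₂)^(p/2) later.
  have hl := one_sub_mul_rpow_le hp ht (by linarith)
  rw [← hm, Real.rpow_sub_one ht.ne', sub_sub_cancel] at hl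
  have hcR : 0 ≤ c * R ^ m := mul_nonneg hc0 (Real.rpow_nonneg hR m)
  have h2 := mul_le_mul_of_nonneg_left hl hcR
  have h3 : c * R ^ m * (δ * ((1 - δ) ^ m / (1 - δ))) ≤ g δ / (1 - δ) := by linarith
  rw [le_div_iff₀ ht] at h3
  have e : c * R ^ m * (δ * ((1 - δ) ^ m / (1 - δ))) * (1 - δ) = c * (δ * (1 - δ) ^ m * R ^ m) := by
    field_simp
  rw [e] at h3
  simp only [hg, hNdef] at h3
  linarith

/-! ### The pointwise ground state inequality for scalars. -/

section NormIdentities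

variable {𝕜 : Type*} [RCLike 𝕜]

lemma norm_sq_convex_combination (x : ℝ) (X Y : 𝕜) :
    ‖(1 - x) • X + x • Y‖ ^ 2 = (1 - x) * ‖X‖ ^ 2 + x * ‖Y‖ ^ 2 - x * (1 - x) * ‖X - Y‖ ^ 2 := by
  simp only [← RCLike.normSq_eq_def', RCLike.normSq_apply, map_add, map_sub, RCLike.smul_re,
    RCLike.smul_im]
  ring

lemma norm_sq_rpow_half (p : ℝ) (X : 𝕜) : (‖X‖ ^ 2) ^ (p / 2) = ‖X‖ ^ p := by
  rw [← Real.rpow_natCast, ← Real.rpow_mul (norm_nonneg _)]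
  congr 1
  push_cast
  ring

lemma norm_jensen_gap_le {p δ : ℝ} (hp : 2 ≤ p) (hδ0 : 0 ≤ δ) (hδ1 : δ < 1) (X Y : 𝕜) :
    ‖(1 - δ) • X + δ • Y‖ ^ p + remainderConst p * (δ * (1 - δ) ^ (p / 2) * ‖X - Y‖ ^ p)
      ≤ (1 - δ) * ‖X‖ ^ p + δ * ‖Y‖ ^ p := by
  have h := jensen_gap_le (P := ‖X‖ ^ 2) (Q := ‖Y‖ ^ 2) (R := ‖X - Y‖ ^ 2) hp (by positivity)
    hδ0 hδ1 (fun x => by rw [← norm_sq_convex_combination]; positivity)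
  rwa [← norm_sq_convex_combination, norm_sq_rpow_half, norm_sq_rpow_half, norm_sq_rpow_half,
    norm_sq_rpow_half] at h

/-- The combination of `(w₁ - w₂) v₂` and `w₁ v₁ - w₂ v₂` with weights `w₂ / w₁`, `1 - w₂ / w₁`. -/
lemma ground_state_combination {w₁ w₂ : ℝ} (h1 : w₁ ≠ 0) (v₁ v₂ : 𝕜) :
    (1 - (w₁ - w₂) / w₁) • ((w₁ - w₂) • v₂) + ((w₁ - w₂) / w₁) • (w₁ • v₁ - w₂ • v₂)
      = (w₁ - w₂) • v₁ := by
  rw [smul_sub, smul_smul, smul_smul, smul_smul, div_mul_cancel₀ _ h1, add_sub_left_comm,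
    ← sub_smul, show (1 - (w₁ - w₂) / w₁) * (w₁ - w₂) - (w₁ - w₂) / w₁ * w₂ = 0 by
      field_simp
      ring, zero_smul, add_zero]

lemma ground_state_difference (w₁ w₂ : ℝ) (v₁ v₂ : 𝕜) :
    (w₁ - w₂) • v₂ - (w₁ • v₁ - w₂ • v₂) = -(w₁ • (v₁ - v₂)) := by
  rw [sub_smul, smul_sub]
  abel

/-- The pointwise ground state inequality. -/
lemma ground_state_le {p w₁ w₂ : ℝ} (hp : 2 ≤ p) (h2 : 0 < w₂) (h12 : w₂ < w₁) (v₁ v₂ : 𝕜) :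
    (w₁ - w₂) ^ (p - 1) * (w₁ * ‖v₁‖ ^ p)
        + remainderConst p * ((w₁ * w₂) ^ (p / 2) * ‖v₁ - v₂‖ ^ p)
      ≤ ‖w₁ • v₁ - w₂ • v₂‖ ^ p + (w₁ - w₂) ^ (p - 1) * (w₂ * ‖v₂‖ ^ p) := by
  have h1 : 0 < w₁ := h2.trans h12
  have hd : 0 < w₁ - w₂ := sub_pos.2 h12
  -- This δ makes the convex combination equal to (w₁ - w₂)v₁, while the endpoints differ by w₁(v₁ -
  -- v₂).
  have h := norm_jensen_gap_le (δ := (w₁ - w₂) / w₁) hp (by positivity)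
    (by rw [div_lt_one h1]; linarith) ((w₁ - w₂) • v₂) (w₁ • v₁ - w₂ • v₂)
  rw [ground_state_combination h1.ne', ground_state_difference, norm_neg, norm_smul, norm_smul,
    norm_smul, Real.norm_of_nonneg hd.le, Real.norm_of_nonneg h1.le,
    Real.mul_rpow hd.le (norm_nonneg _), Real.mul_rpow hd.le (norm_nonneg _),
    Real.mul_rpow h1.le (norm_nonneg _), show 1 - (w₁ - w₂) / w₁ = w₂ / w₁ by field_simp; ring,
    Real.div_rpow h2.le h1.le] at h
  have e1 : (w₁ - w₂) ^ p = (w₁ - w₂) ^ (p - 1) * (w₁ - w₂) := by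
    rw [← Real.rpow_add_one hd.ne']
    congr 1
    ring
  have e2 : w₁ ^ p = w₁ ^ (p / 2) * w₁ ^ (p / 2) := by
    rw [← Real.rpow_add h1]
    congr 1
    ring
  rw [e1, e2] at h
  rw [Real.mul_rpow h1.le h2.le]
  have hw : 0 < w₁ ^ (p / 2) := by positivity
  -- The factor w₁/(w₁ - w₂) = 1/δ normalizes the coefficient of |w₁v₁ - w₂v₂|^p to 1.
  have hm := mul_le_mul_of_nonneg_left h (div_pos h1 hd).le
  refine le_trans (le_of_eq ?_) (hm.trans (le_of_eq ?_))
  · field_simp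
  · field_simp
    ring

/-- For `p = 2` the pointwise ground state inequality is an identity. -/
lemma ground_state_eq {w₁ w₂ : ℝ} (v₁ v₂ : 𝕜) :
    (w₁ - w₂) * (w₁ * ‖v₁‖ ^ 2) + w₁ * w₂ * ‖v₁ - v₂‖ ^ 2
      = ‖w₁ • v₁ - w₂ • v₂‖ ^ 2 + (w₁ - w₂) * (w₂ * ‖v₂‖ ^ 2) := by
  simp only [← RCLike.normSq_eq_def', RCLike.normSq_apply, map_sub, RCLike.smul_re,
    RCLike.smul_im]
  ring

end NormIdentities

/-! ### Polar coordinates for functions of the norm and one coordinate. -/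

section Zonal

open Module ENNReal

/-- Integration in polar coordinates of a nonnegative radial function. -/
lemma lintegral_fun_norm {E : Type*} [NormedAddCommGroup E] [NormedSpace ℝ E]
    [MeasurableSpace E] [BorelSpace E] [FiniteDimensional ℝ E] [Nontrivial E] (μ : Measure E)
    [μ.IsAddHaarMeasure] {f : ℝ → ℝ≥0∞} (hf : Measurable f) :
    ∫⁻ x, f ‖x‖ ∂μ
      = μ.toSphere univ * ∫⁻ r in Ioi (0 : ℝ), ENNReal.ofReal (r ^ (finrank ℝ E - 1)) * f r := by
  calc
    ∫⁻ x, f ‖x‖ ∂μ = ∫⁻ x : ({(0)}ᶜ : Set E), f ‖x.1‖ ∂(μ.comap (↑)) := by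
      rw [lintegral_subtype_comap (measurableSet_singleton _).compl fun x ↦ f ‖x‖,
        MeasureTheory.restrict_compl_singleton]
    _ = ∫⁻ x, f x.2 ∂μ.toSphere.prod (.volumeIoiPow (finrank ℝ E - 1)) := by
      have h := μ.measurePreserving_homeomorphUnitSphereProd.lintegral_comp
        (f := fun x => f x.2) (by fun_prop)
      rw [← h]
      simp
    _ = ∫⁻ _x, ∫⁻ r : Ioi (0 : ℝ), f r ∂.volumeIoiPow (finrank ℝ E - 1) ∂μ.toSphere :=
      lintegral_prod _ (by fun_prop)
    _ = _ := by
      rw [lintegral_const, mul_comm]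
      congr 1
      rw [Measure.volumeIoiPow, lintegral_withDensity_eq_lintegral_mul _ (by fun_prop)
        (by fun_prop)]
      exact lintegral_subtype_comap measurableSet_Ioi
        (fun r : ℝ => ENNReal.ofReal (r ^ (finrank ℝ E - 1)) * f r)

lemma ofReal_sphereArea (n : ℕ) : ENNReal.ofReal (sphereArea n)
    = (volume : Measure (EuclideanSpace ℝ (Fin n))).toSphere univ := by
  rw [sphereArea, ofReal_measureReal]

/-- The isometry `ℝⁿ⁺¹ ≃ ℝ × ℝⁿ` splitting off the first coordinate preserves the volume. -/
lemma lintegral_euclideanSpace_succ (n : ℕ) {f : EuclideanSpace ℝ (Fin (n + 1)) → ℝ≥0∞}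
    {g : ℝ → EuclideanSpace ℝ (Fin n) → ℝ≥0∞} (hg : Measurable (Function.uncurry g))
    (h : ∀ y, f y = g (y 0) (WithLp.toLp 2 fun i => y i.succ)) :
    ∫⁻ y, f y = ∫⁻ t, ∫⁻ z, g t z := by
  have h1 := ((volume_preserving_piFinSuccAbove (fun _ : Fin (n + 1) => ℝ) 0).comp
    (PiLp.volume_preserving_ofLp (Fin (n + 1))))
  have h2 : MeasurePreserving (Prod.map id (WithLp.toLp 2) :
      ℝ × (Fin n → ℝ) → ℝ × EuclideanSpace ℝ (Fin n)) :=
    (MeasurePreserving.id _).prod (PiLp.volume_preserving_toLp (Fin n))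
  have h3 := (h2.comp h1).lintegral_comp hg
  rw [Measure.volume_eq_prod, lintegral_prod _ hg.aemeasurable] at h3
  rw [show ∫⁻ t, ∫⁻ z, g t z = _ from h3.symm]
  refine lintegral_congr fun y => ?_
  rw [h]
  rfl

lemma norm_euclideanSpace_succ (n : ℕ) (y : EuclideanSpace ℝ (Fin (n + 1))) :
    ‖y‖ = √(y 0 ^ 2 + ‖(WithLp.toLp 2 fun i => y i.succ : EuclideanSpace ℝ (Fin n))‖ ^ 2) := by
  rw [EuclideanSpace.norm_eq, EuclideanSpace.norm_sq_eq, Fin.sum_univ_succ]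
  simp

lemma cos_image_Ioo : Real.cos '' Ioo 0 Real.pi = Ioo (-1) 1 := by
  ext t
  constructor
  · rintro ⟨x, hx, rfl⟩
    constructor
    · rw [← Real.cos_pi]
      exact Real.strictAntiOn_cos ⟨hx.1.le, hx.2.le⟩ ⟨Real.pi_pos.le, le_rfl⟩ hx.2
    · rw [← Real.cos_zero]
      exact Real.strictAntiOn_cos ⟨le_rfl, Real.pi_pos.le⟩ ⟨hx.1.le, hx.2.le⟩ hx.1
  · intro ht
    refine ⟨Real.arccos t, ⟨Real.arccos_pos.2 ht.2, ?_⟩, Real.cos_arccos ht.1.le ht.2.le⟩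
    refine lt_of_le_of_ne (Real.arccos_le_pi t) fun h => ?_
    rw [Real.arccos_eq_pi] at h
    linarith [ht.1]

/-- The substitution `t = cos θ`. -/
lemma lintegral_Ioo_eq_lintegral_cos (n : ℕ) (g : ℝ → ℝ≥0∞) :
    ∫⁻ t in Ioo (-1 : ℝ) 1, ENNReal.ofReal ((1 - t ^ 2) ^ (((n : ℝ) - 1) / 2)) * g t
      = ∫⁻ θ in Ioo 0 Real.pi, ENNReal.ofReal (Real.sin θ ^ n) * g (Real.cos θ) := by
  rw [← cos_image_Ioo, lintegral_image_eq_lintegral_abs_deriv_mul measurableSet_Ioo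
    (fun x _ => (Real.hasDerivAt_cos x).hasDerivWithinAt)
    (Real.injOn_cos.mono Ioo_subset_Icc_self)]
  refine setLIntegral_congr_fun measurableSet_Ioo fun θ hθ => ?_
  have hs : 0 < Real.sin θ := Real.sin_pos_of_mem_Ioo hθ
  rw [← mul_assoc, ← ENNReal.ofReal_mul (abs_nonneg _), abs_neg, abs_of_pos hs, ← Real.sin_sq,
    ← Real.rpow_natCast (Real.sin θ) 2, ← Real.rpow_mul hs.le, mul_comm (Real.sin θ),
    ← Real.rpow_add_one hs.ne', ← Real.rpow_natCast]
  congr 4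
  push_cast
  ring

/-- Integration in polar coordinates of a function of `‖y‖` and the first coordinate of `y`. -/
lemma lintegral_zonal (n : ℕ) {G : ℝ → ℝ → ℝ≥0∞} (hG : Measurable (Function.uncurry G)) :
    ∫⁻ y : EuclideanSpace ℝ (Fin (n + 2)), G ‖y‖ (y 0)
      = ENNReal.ofReal (sphereArea (n + 1)) * ∫⁻ r in Ioi (0 : ℝ), ENNReal.ofReal (r ^ (n + 1)) *
          ∫⁻ t in Ioo (-1 : ℝ) 1,
            ENNReal.ofReal ((1 - t ^ 2) ^ (((n : ℝ) - 1) / 2)) * G r (r * t) := by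
  have hGm : ∀ {α : Type} [MeasurableSpace α] {a b : α → ℝ}, Measurable a → Measurable b →
      Measurable fun x => G (a x) (b x) := fun ha hb => hG.comp (ha.prodMk hb)
  -- Write y = (t, z), use polar coordinates in z, and then planar polar coordinates in (t, |z|) =
  -- (r cos θ, r sin θ).
  rw [lintegral_euclideanSpace_succ (n + 1) (g := fun t z => G √(t ^ 2 + ‖z‖ ^ 2) t)
    (hGm (by fun_prop) (by fun_prop)) (fun y => by rw [← norm_euclideanSpace_succ])]
  have h1 : ∀ t, ∫⁻ z : EuclideanSpace ℝ (Fin (n + 1)), G √(t ^ 2 + ‖z‖ ^ 2) t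
      = ENNReal.ofReal (sphereArea (n + 1)) * ∫⁻ ρ, (Ioi (0 : ℝ)).indicator
        (fun ρ => ENNReal.ofReal (ρ ^ n) * G √(t ^ 2 + ρ ^ 2) t) ρ := fun t => by
    rw [lintegral_fun_norm volume (f := fun ρ => G √(t ^ 2 + ρ ^ 2) t)
      (hGm (by fun_prop) (by fun_prop)), ofReal_sphereArea, lintegral_indicator measurableSet_Ioi]
    simp
  have hm : Measurable fun q : ℝ × ℝ => (Ioi (0 : ℝ)).indicator
        (fun ρ => ENNReal.ofReal (ρ ^ n) * G √(q.1 ^ 2 + ρ ^ 2) q.1) q.2 := by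
    have : (fun q : ℝ × ℝ => (Ioi (0 : ℝ)).indicator
        (fun ρ => ENNReal.ofReal (ρ ^ n) * G √(q.1 ^ 2 + ρ ^ 2) q.1) q.2)
        = (Prod.snd ⁻¹' Ioi (0 : ℝ)).indicator
          fun q : ℝ × ℝ => ENNReal.ofReal (q.2 ^ n) * G √(q.1 ^ 2 + q.2 ^ 2) q.1 := by
      ext q
      simp only [indicator, mem_preimage]
    rw [this]
    exact Measurable.indicator (.mul (by fun_prop) (hGm (by fun_prop) (by fun_prop)))
      (measurable_snd measurableSet_Ioi)
  simp_rw [h1]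
  rw [lintegral_const_mul _ hm.lintegral_prod_right']
  congr 1
  rw [← lintegral_prod _ hm.aemeasurable, ← Measure.volume_eq_prod, ← lintegral_comp_polarCoord_symm,
    polarCoord_target, Measure.volume_eq_prod, ← Measure.prod_restrict]
  have hm2 : Measurable fun q : ℝ × ℝ => ENNReal.ofReal q.1 • (Ioi (0 : ℝ)).indicator
        (fun ρ => ENNReal.ofReal (ρ ^ n) * G √((polarCoord.symm q).1 ^ 2 + ρ ^ 2)
          (polarCoord.symm q).1) (polarCoord.symm q).2 :=
    Measurable.smul (f := fun q : ℝ × ℝ => ENNReal.ofReal q.1) (by fun_prop) (hm.comp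
      (show Measurable fun q : ℝ × ℝ => (q.1 * Real.cos q.2, q.1 * Real.sin q.2) by fun_prop))
  rw [lintegral_prod _ hm2.aemeasurable]
  refine setLIntegral_congr_fun measurableSet_Ioi fun r (hr : 0 < r) => ?_
  simp only [polarCoord_symm_apply]
  rw [lintegral_Ioo_eq_lintegral_cos, ← lintegral_const_mul' _ _ ENNReal.ofReal_ne_top,
    ← lintegral_indicator measurableSet_Ioo, ← lintegral_indicator measurableSet_Ioo]
  refine lintegral_congr fun θ => ?_
  by_cases hθ : θ ∈ Ioo 0 Real.pi
  · have hs : 0 < Real.sin θ := Real.sin_pos_of_mem_Ioo hθ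
    have hθ' : θ ∈ Ioo (-Real.pi) Real.pi := ⟨by linarith [hθ.1, hθ.2], hθ.2⟩
    rw [indicator_of_mem hθ, indicator_of_mem hθ', indicator_of_mem (show r * Real.sin θ ∈ Ioi 0 from mul_pos hr hs),
      show (r * Real.cos θ) ^ 2 + (r * Real.sin θ) ^ 2 = r ^ 2 by
        rw [mul_pow, mul_pow, ← mul_add, Real.cos_sq_add_sin_sq, mul_one], Real.sqrt_sq hr.le,
      smul_eq_mul, ← mul_assoc, ← mul_assoc, ← ENNReal.ofReal_mul hr.le,
      ← ENNReal.ofReal_mul (by positivity)]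
    congr 2
    ring
  · rw [indicator_of_notMem hθ]
    -- Angles in (-π, 0] have sin θ ≤ 0 and lie outside the half-plane |z| > 0, so the indicator
    -- vanishes.
    by_cases hθ' : θ ∈ Ioo (-Real.pi) Real.pi
    · rw [indicator_of_mem hθ', indicator_of_notMem, smul_zero]
      have h0 : θ ≤ 0 := by
        by_contra h
        exact hθ ⟨not_le.1 h, hθ'.2⟩
      have := Real.sin_nonpos_of_nonpos_of_neg_pi_le h0 hθ'.1.le
      simp only [mem_Ioi, not_lt]
      exact mul_nonpos_of_nonneg_of_nonpos hr.le this
    · rw [indicator_of_notMem hθ']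

end Zonal

/-! ### The kernel averaged over spheres, and its relation to Φ. -/

section Kernel

open ENNReal

/-- The integral of `‖x - y‖ ^ (-(d + σ))` over the sphere `‖y‖ = r`, for `‖x‖ = R`, normalized by
the factor `r ^ (d - 1)`. -/
noncomputable def sphericalKernel (d : ℕ) (σ R r : ℝ) : ℝ≥0∞ :=
  if d = 1 then ENNReal.ofReal (|R - r| ^ (-1 - σ)) + ENNReal.ofReal ((R + r) ^ (-1 - σ))
  else ENNReal.ofReal (sphereArea (d - 1)) *
    ∫⁻ t in Ioo (-1 : ℝ) 1, ENNReal.ofReal ((1 - t ^ 2) ^ (((d : ℝ) - 3) / 2)) *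
      ENNReal.ofReal ((R ^ 2 - 2 * R * r * t + r ^ 2) ^ (-(((d : ℝ) + σ) / 2)))

lemma sphericalKernel_comm (d : ℕ) (σ R r : ℝ) :
    sphericalKernel d σ R r = sphericalKernel d σ r R := by
  unfold sphericalKernel
  rw [abs_sub_comm, add_comm R r]
  have : ∀ t : ℝ, R ^ 2 - 2 * R * r * t + r ^ 2 = r ^ 2 - 2 * r * R * t + R ^ 2 := fun t => by ring
  simp only [this]

lemma sphericalKernel_base_nonneg (R r : ℝ) {t : ℝ} (ht : t ∈ Ioo (-1 : ℝ) 1) :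
    0 ≤ R ^ 2 - 2 * R * r * t + r ^ 2 := by
  have h1 : t ^ 2 ≤ 1 := by nlinarith [ht.1, ht.2]
  nlinarith [sq_nonneg (R - r * t), mul_nonneg (sq_nonneg r) (sub_nonneg.2 h1)]

lemma sphericalKernel_mul (d : ℕ) (σ : ℝ) {l R r : ℝ} (hl : 0 < l) (hR : 0 ≤ R) (hr : 0 ≤ r) :
    sphericalKernel d σ (l * R) (l * r)
      = ENNReal.ofReal (l ^ (-((d : ℝ) + σ))) * sphericalKernel d σ R r := by
  unfold sphericalKernel
  split_ifs with h
  · subst h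
    rw [← mul_sub, abs_mul, abs_of_pos hl, ← mul_add, Real.mul_rpow hl.le (abs_nonneg _),
      Real.mul_rpow hl.le (by positivity), ENNReal.ofReal_mul (by positivity),
      ENNReal.ofReal_mul (by positivity), ← mul_add,
      show -((1 : ℕ) + σ) = -1 - σ by push_cast; ring]
  · rw [mul_left_comm (ENNReal.ofReal (l ^ (-((d : ℝ) + σ)))),
      ← lintegral_const_mul' (ENNReal.ofReal (l ^ (-((d : ℝ) + σ)))) _ ENNReal.ofReal_ne_top]
    congr 1
    refine setLIntegral_congr_fun measurableSet_Ioo fun t ht => ?_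
    rw [show (l * R) ^ 2 - 2 * (l * R) * (l * r) * t + (l * r) ^ 2
        = l ^ 2 * (R ^ 2 - 2 * R * r * t + r ^ 2) by ring,
      Real.mul_rpow (by positivity) (sphericalKernel_base_nonneg R r ht),
      ENNReal.ofReal_mul (by positivity), ← Real.rpow_natCast l 2, ← Real.rpow_mul hl.le,
      mul_left_comm]
    congr 3
    push_cast
    ring

lemma lintegral_one_sub_sq_rpow_lt_top (n : ℕ) :
    ∫⁻ t in Ioo (-1 : ℝ) 1, ENNReal.ofReal ((1 - t ^ 2) ^ (((n : ℝ) - 1) / 2)) < ⊤ := by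
  have h := lintegral_Ioo_eq_lintegral_cos n 1
  simp only [Pi.one_apply, mul_one] at h
  rw [h]
  calc ∫⁻ θ in Ioo 0 Real.pi, ENNReal.ofReal (Real.sin θ ^ n)
      ≤ ∫⁻ _θ in Ioo 0 Real.pi, 1 := by
        refine setLIntegral_mono' measurableSet_Ioo fun θ hθ => ?_
        rw [← ENNReal.ofReal_one]
        exact ENNReal.ofReal_le_ofReal
          (pow_le_one₀ (Real.sin_pos_of_mem_Ioo hθ).le (Real.sin_le_one θ))
    _ < ⊤ := by simp

/-- For r < 1 the denominator base is at least (1 - r)² > 0, so the angular integral is finite and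
its Bochner and Lebesgue versions agree. -/
lemma ofReal_hardyPhi {d : ℕ} (hd : 1 ≤ d) {s p r : ℝ} (hsp : 0 < s * p)
    (hr : r ∈ Ioo (0 : ℝ) 1) :
    ENNReal.ofReal (hardyPhi d s p r) = sphericalKernel d (s * p) 1 r := by
  have hr1 : 0 < 1 - r := by linarith [hr.2]
  have hr0 := hr.1
  unfold hardyPhi sphericalKernel
  split_ifs with h
  · rw [ENNReal.ofReal_add (by positivity) (by positivity), abs_of_pos hr1]
  · obtain ⟨n, rfl⟩ : ∃ n, d = n + 2 := ⟨d - 2, by omega⟩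
    have e3 : (((n + 2 : ℕ) : ℝ) - 3) / 2 = ((n : ℝ) - 1) / 2 := by push_cast; ring
    have hlow : ∀ t ∈ Ioo (-1 : ℝ) 1, (1 - r) ^ 2 ≤ 1 - 2 * t * r + r ^ 2 := fun t ht => by
      nlinarith [ht.2]
    set q := (((n + 2 : ℕ) : ℝ) + s * p) / 2 with hq
    have hq0 : 0 < q := by positivity
    have hnn : ∀ t ∈ Ioo (-1 : ℝ) 1, 0 ≤ 1 - t ^ 2 := fun t ht => by nlinarith [ht.1, ht.2]
    have hval : ∀ t ∈ Ioo (-1 : ℝ) 1,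
        ENNReal.ofReal ((1 - t ^ 2) ^ ((((n + 2 : ℕ) : ℝ) - 3) / 2)
          / (1 - 2 * t * r + r ^ 2) ^ q)
        = ENNReal.ofReal ((1 - t ^ 2) ^ ((((n + 2 : ℕ) : ℝ) - 3) / 2)) *
          ENNReal.ofReal ((1 ^ 2 - 2 * 1 * r * t + r ^ 2) ^ (-q)) := fun t ht => by
      have hpos : 0 < 1 - 2 * t * r + r ^ 2 := lt_of_lt_of_le (by positivity) (hlow t ht)
      rw [← ENNReal.ofReal_mul (Real.rpow_nonneg (hnn t ht) _),
        show (1 : ℝ) ^ 2 - 2 * 1 * r * t + r ^ 2 = 1 - 2 * t * r + r ^ 2 by ring,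
        Real.rpow_neg hpos.le, div_eq_mul_inv]
    rw [ENNReal.ofReal_mul (by unfold sphereArea; positivity), ofReal_integral_eq_lintegral_ofReal]
    · congr 1
      exact setLIntegral_congr_fun measurableSet_Ioo hval
    · refine ⟨Measurable.aestronglyMeasurable (by fun_prop), ?_⟩
      rw [hasFiniteIntegral_iff_ofReal]
      · calc _ ≤ ∫⁻ t in Ioo (-1 : ℝ) 1, ENNReal.ofReal ((1 - t ^ 2) ^ (((n : ℝ) - 1) / 2)) *
              ENNReal.ofReal (((1 - r) ^ 2) ^ (-q)) := by
              refine setLIntegral_mono' measurableSet_Ioo fun t ht => ?_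
              rw [hval t ht, e3]
              gcongr 1
              refine ENNReal.ofReal_le_ofReal ?_
              refine Real.rpow_le_rpow_of_nonpos (by positivity) ?_ (by linarith)
              have := hlow t ht
              linarith
          _ < ⊤ := by
              rw [lintegral_mul_const' _ _ ENNReal.ofReal_ne_top]
              exact ENNReal.mul_lt_top (lintegral_one_sub_sq_rpow_lt_top n) ENNReal.ofReal_lt_top
      · refine (ae_restrict_mem measurableSet_Ioo).mono fun t ht => ?_
        have hpos : 0 < 1 - 2 * t * r + r ^ 2 := lt_of_lt_of_le (by positivity) (hlow t ht)
        exact div_nonneg (Real.rpow_nonneg (hnn t ht) _) (Real.rpow_nonneg hpos.le _)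
    · refine (ae_restrict_mem measurableSet_Ioo).mono fun t ht => ?_
      have hpos : 0 < 1 - 2 * t * r + r ^ 2 := lt_of_lt_of_le (by positivity) (hlow t ht)
      exact div_nonneg (Real.rpow_nonneg (hnn t ht) _) (Real.rpow_nonneg hpos.le _)

lemma hardyPhi_nonneg (d : ℕ) (s p : ℝ) {r : ℝ} (hr : r ∈ Ioo (0 : ℝ) 1) :
    0 ≤ hardyPhi d s p r := by
  have hr1 : 0 < 1 - r := by linarith [hr.2]
  have hr0 := hr.1
  unfold hardyPhi
  split_ifs with h
  · positivity
  · refine mul_nonneg (by unfold sphereArea; positivity)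
      (setIntegral_nonneg measurableSet_Ioo fun t ht => ?_)
    have h1 : 0 ≤ 1 - t ^ 2 := by nlinarith [ht.1, ht.2]
    have h2 : 0 ≤ 1 - 2 * t * r + r ^ 2 := by
      have := sphericalKernel_base_nonneg 1 r ht
      linarith
    exact div_nonneg (Real.rpow_nonneg h1 _) (Real.rpow_nonneg h2 _)

lemma measurable_hardyPhi (d : ℕ) (s p : ℝ) : Measurable (hardyPhi d s p) := by
  unfold hardyPhi
  split_ifs with h
  · fun_prop
  · refine Measurable.const_mul (StronglyMeasurable.measurable ?_) _
    exact StronglyMeasurable.integral_prod_right (f := fun r t : ℝ =>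
      (1 - t ^ 2) ^ (((d : ℝ) - 3) / 2) / (1 - 2 * t * r + r ^ 2) ^ (((d : ℝ) + s * p) / 2))
      (Measurable.stronglyMeasurable (by
        simp only [Function.uncurry_def]
        fun_prop))

/-- Integrals of functions of `‖y‖` and `‖x - y‖` depend on `x` only through `‖x‖`. -/
lemma lintegral_norm_norm_sub_congr {d : ℕ} {x e : EuclideanSpace ℝ (Fin d)} (h : ‖x‖ = ‖e‖)
    (G : ℝ → ℝ → ℝ≥0∞) :
    ∫⁻ y, G ‖y‖ ‖x - y‖ = ∫⁻ y, G ‖y‖ ‖e - y‖ := by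
  -- The reflection in the hyperplane orthogonal to x - e maps x to e when their norms agree, and it
  -- preserves volume.
  let T := Submodule.reflection (Submodule.span ℝ {x - e})ᗮ
  have hT : T x = e := Submodule.reflection_sub h
  symm
  rw [← T.measurePreserving.lintegral_comp_emb T.toMeasurableEquiv.measurableEmbedding]
  refine lintegral_congr fun y => ?_
  rw [← hT, ← map_sub, T.norm_map, T.norm_map]

lemma lintegral_euclideanSpace_one {h : ℝ → ℝ≥0∞} (hh : Measurable h) :
    ∫⁻ y : EuclideanSpace ℝ (Fin 1), h (y 0) = ∫⁻ t, h t :=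
  ((volume_preserving_funUnique (Fin 1) ℝ).comp
    (PiLp.volume_preserving_ofLp (Fin 1))).lintegral_comp hh

lemma lintegral_eq_lintegral_Ioi_add (h : ℝ → ℝ≥0∞) :
    ∫⁻ t, h t = (∫⁻ t in Ioi (0 : ℝ), h t) + ∫⁻ t in Ioi (0 : ℝ), h (-t) := by
  rw [← lintegral_add_compl h measurableSet_Ioi (A := Ioi (0 : ℝ)), compl_Ioi]
  congr 1
  have := (Measure.measurePreserving_neg (volume : Measure ℝ)).setLIntegral_comp_preimage_emb
    (MeasurableEquiv.neg ℝ).measurableEmbedding h (Iio 0)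
  rw [setLIntegral_congr Iio_ae_eq_Iic.symm, ← this]
  simp

/-- Integration in polar coordinates of a radial function against the kernel
`‖x - y‖ ^ (-(d + σ))`. -/
lemma lintegral_radial_mul_kernel {d : ℕ} (hd : 1 ≤ d) (σ : ℝ) {g : ℝ → ℝ≥0∞} (hg : Measurable g)
    (x : EuclideanSpace ℝ (Fin d)) :
    ∫⁻ y, g ‖y‖ * ENNReal.ofReal (‖x - y‖ ^ (-((d : ℝ) + σ)))
      = ∫⁻ r in Ioi (0 : ℝ), ENNReal.ofReal (r ^ (d - 1)) *
          (g r * sphericalKernel d σ ‖x‖ r) := by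
  obtain ⟨k, rfl⟩ : ∃ k, d = k + 1 := ⟨d - 1, by omega⟩
  rw [lintegral_norm_norm_sub_congr (e := EuclideanSpace.single 0 ‖x‖) (by simp)
    (fun a b => g a * ENNReal.ofReal (b ^ (-(((k + 1 : ℕ) : ℝ) + σ))))]
  generalize hR : ‖x‖ = R
  have hR0 : 0 ≤ R := hR ▸ norm_nonneg x
  rcases k with _ | n
  · have h1 : ∀ y : EuclideanSpace ℝ (Fin 1), ‖y‖ = |y 0| := fun y => by
      rw [EuclideanSpace.norm_eq]
      simp [Real.sqrt_sq_eq_abs]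
    simp_rw [zero_add, h1]
    have h2 : ∀ y : EuclideanSpace ℝ (Fin 1), (EuclideanSpace.single 0 R - y : EuclideanSpace ℝ (Fin 1)) 0 = R - y 0 :=
      fun y => by simp
    simp_rw [h2]
    rw [lintegral_euclideanSpace_one
      (h := fun t => g |t| * ENNReal.ofReal (|R - t| ^ (-(((1 : ℕ) : ℝ) + σ)))) (by fun_prop),
      lintegral_eq_lintegral_Ioi_add, ← lintegral_add_left (by fun_prop)]
    refine setLIntegral_congr_fun measurableSet_Ioi fun r (hr : 0 < r) => ?_
    simp only [sphericalKernel, if_true]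
    rw [abs_neg, abs_of_pos hr, sub_neg_eq_add, abs_of_nonneg (by positivity : 0 ≤ R + r),
      ← mul_add]
    simp [sub_eq_add_neg, add_comm]
  · have h1 : ∀ y : EuclideanSpace ℝ (Fin (n + 2)),
        ‖EuclideanSpace.single 0 R - y‖ ^ (-(((n + 2 : ℕ) : ℝ) + σ))
          = (R ^ 2 - 2 * R * y 0 + ‖y‖ ^ 2) ^ (-((((n + 2 : ℕ) : ℝ) + σ) / 2)) := fun y => by
      have : ‖EuclideanSpace.single 0 R - y‖ ^ 2 = R ^ 2 - 2 * R * y 0 + ‖y‖ ^ 2 := by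
        rw [norm_sub_sq_real, EuclideanSpace.inner_single_left]
        simp
        ring
      rw [← this, ← Real.rpow_natCast, ← Real.rpow_mul (norm_nonneg _)]
      congr 1
      push_cast
      ring
    simp_rw [show n + 1 + 1 = n + 2 from rfl, h1]
    rw [lintegral_zonal n (G := fun a b => g a *
      ENNReal.ofReal ((R ^ 2 - 2 * R * b + a ^ 2) ^ (-((((n + 2 : ℕ) : ℝ) + σ) / 2))))
      (by simp only [Function.uncurry_def]; fun_prop),
      ← lintegral_const_mul' _ _ ENNReal.ofReal_ne_top]
    refine setLIntegral_congr_fun measurableSet_Ioi fun r (hr : 0 < r) => ?_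
    simp only [sphericalKernel]
    rw [if_neg (by omega)]
    have e : (((n + 2 : ℕ) : ℝ) - 3) / 2 = ((n : ℝ) - 1) / 2 := by push_cast; ring
    simp_rw [e, show n + 2 - 1 = n + 1 from rfl]
    rw [mul_left_comm, mul_left_comm (g r)]
    congr 2
    rw [← lintegral_const_mul _ (by fun_prop)]
    refine lintegral_congr fun t => ?_
    rw [show 2 * R * (r * t) = 2 * R * r * t by ring]
    ring

end Kernel

/-! ### Scaling to the unit interval, and convergence of the integral 𝒞. -/

section Coefficients

open ENNReal

lemma image_mul_Ioo {R θ : ℝ} (hR : 0 < R) :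
    (fun ρ => R * ρ) '' Ioo 0 θ = Ioo 0 (θ * R) := by
  rw [image_mul_left_Ioo hR, mul_zero, mul_comm]

lemma image_div_Ioo {R θ : ℝ} (hR : 0 < R) (hθ : 0 < θ) :
    (fun ρ => R / ρ) '' Ioo 0 θ = {r | R < θ * r} := by
  ext r
  constructor
  · rintro ⟨ρ, hρ, rfl⟩
    have := hρ.1
    simp only [mem_ofPred_eq]
    rw [mul_div_assoc', lt_div_iff₀ hρ.1, mul_comm]
    exact mul_lt_mul_of_pos_right hρ.2 hR
  · intro (hr : R < θ * r)
    have hr0 : 0 < r := by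
      by_contra h
      nlinarith [not_lt.1 h]
    exact ⟨R / r, ⟨by positivity, by rwa [div_lt_iff₀ hr0]⟩, by simp only; field_simp⟩

/-- The part of a radial integral against the kernel that lies inside a smaller ball. -/
lemma lintegral_inner {d : ℕ} (hd : 1 ≤ d) {s p θ : ℝ} (hsp : 0 < s * p) (hθ1 : θ ≤ 1)
    {g : ℝ → ℝ≥0∞} (hg : Measurable g) {x : EuclideanSpace ℝ (Fin d)} (hx : x ≠ 0) :
    ∫⁻ y, (Iio (θ * ‖x‖)).indicator g ‖y‖ * ENNReal.ofReal (‖x - y‖ ^ (-((d : ℝ) + s * p)))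
      = ENNReal.ofReal (‖x‖ ^ (-(s * p))) * ∫⁻ ρ in Ioo 0 θ,
          ENNReal.ofReal (ρ ^ ((d : ℝ) - 1)) * g (‖x‖ * ρ) * ENNReal.ofReal (hardyPhi d s p ρ) := by
  have hR : 0 < ‖x‖ := norm_pos_iff.2 hx
  rw [lintegral_radial_mul_kernel hd _ (hg.indicator measurableSet_Iio)]
  generalize ‖x‖ = R at *
  have h1 : ∫⁻ r in Ioi (0 : ℝ), ENNReal.ofReal (r ^ (d - 1)) *
      ((Iio (θ * R)).indicator g r * sphericalKernel d (s * p) R r)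
      = ∫⁻ r in Ioo 0 (θ * R), ENNReal.ofReal (r ^ (d - 1)) *
      (g r * sphericalKernel d (s * p) R r) := by
    rw [← lintegral_indicator measurableSet_Ioi, ← lintegral_indicator measurableSet_Ioo]
    refine lintegral_congr fun r => ?_
    by_cases h0 : 0 < r <;> by_cases h1 : r < θ * R <;> simp [indicator, h0, h1]
  rw [h1, ← image_mul_Ioo hR, lintegral_image_eq_lintegral_abs_deriv_mul measurableSet_Ioo
    (f := fun ρ => R * ρ) (f' := fun _ => R * 1) (fun ρ _ => ((hasDerivAt_id ρ).const_mul R).hasDerivWithinAt)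
    (fun a _ b _ h => mul_left_cancel₀ hR.ne' h), ← lintegral_const_mul' _ _ ENNReal.ofReal_ne_top]
  refine setLIntegral_congr_fun measurableSet_Ioo fun ρ hρ => ?_
  have hρ0 := hρ.1
  have hk : sphericalKernel d (s * p) R (R * ρ)
      = ENNReal.ofReal (R ^ (-((d : ℝ) + s * p))) * ENNReal.ofReal (hardyPhi d s p ρ) := by
    rw [ofReal_hardyPhi hd hsp ⟨hρ.1, hρ.2.trans_le hθ1⟩, ← sphericalKernel_mul d _ hR zero_le_one
      hρ0.le, mul_one]
  simp only [mul_one]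
  rw [hk, abs_of_pos hR]
  have e : R * (R * ρ) ^ (d - 1) * R ^ (-((d : ℝ) + s * p))
      = R ^ (-(s * p)) * ρ ^ ((d : ℝ) - 1) := by
    obtain ⟨k, rfl⟩ : ∃ k, d = k + 1 := ⟨d - 1, by omega⟩
    rw [mul_pow, show -(((k + 1 : ℕ) : ℝ) + s * p) = -(s * p) - ((k + 1 : ℕ) : ℝ) by ring,
      Real.rpow_sub hR, Real.rpow_natCast, show ((k + 1 : ℕ) : ℝ) - 1 = (k : ℝ) by push_cast; ring,
      Real.rpow_natCast, Nat.add_sub_cancel]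
    field_simp
    ring
  calc _ = ENNReal.ofReal (R * (R * ρ) ^ (d - 1) * R ^ (-((d : ℝ) + s * p))) * g (R * ρ)
        * ENNReal.ofReal (hardyPhi d s p ρ) := by
        rw [ENNReal.ofReal_mul (by positivity), ENNReal.ofReal_mul hR.le]
        ring
    _ = _ := by
        rw [e, ENNReal.ofReal_mul (by positivity)]
        ring

/-- The part of a radial integral against the kernel that lies outside a larger ball. -/
lemma lintegral_outer {d : ℕ} (hd : 1 ≤ d) {s p θ : ℝ} (hsp : 0 < s * p) (hθ0 : 0 < θ)
    (hθ1 : θ ≤ 1) {g : ℝ → ℝ≥0∞} (hg : Measurable g) {x : EuclideanSpace ℝ (Fin d)} (hx : x ≠ 0) :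
    ∫⁻ y, {r | ‖x‖ < θ * r}.indicator g ‖y‖ * ENNReal.ofReal (‖x - y‖ ^ (-((d : ℝ) + s * p)))
      = ENNReal.ofReal (‖x‖ ^ (-(s * p))) * ∫⁻ ρ in Ioo 0 θ,
          ENNReal.ofReal (ρ ^ (s * p - 1)) * g (‖x‖ / ρ) * ENNReal.ofReal (hardyPhi d s p ρ) := by
  have hR : 0 < ‖x‖ := norm_pos_iff.2 hx
  rw [lintegral_radial_mul_kernel hd _
    (hg.indicator (measurableSet_lt measurable_const (by fun_prop)))]
  generalize ‖x‖ = R at *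
  have hms : MeasurableSet {r | R < θ * r} := measurableSet_lt measurable_const (by fun_prop)
  have h1 : ∫⁻ r in Ioi (0 : ℝ), ENNReal.ofReal (r ^ (d - 1)) *
      ({r | R < θ * r}.indicator g r * sphericalKernel d (s * p) R r)
      = ∫⁻ r in {r | R < θ * r}, ENNReal.ofReal (r ^ (d - 1)) *
      (g r * sphericalKernel d (s * p) R r) := by
    rw [← lintegral_indicator measurableSet_Ioi, ← lintegral_indicator hms]
    refine lintegral_congr fun r => ?_
    by_cases h1 : R < θ * r
    · have h0 : 0 < r := by
        by_contra h
        nlinarith [not_lt.1 h]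
      simp [indicator, h0, h1]
    · simp [indicator, h1]
  rw [h1, ← image_div_Ioo hR hθ0, lintegral_image_eq_lintegral_abs_deriv_mul measurableSet_Ioo
    (f := fun ρ => R / ρ) (f' := fun ρ => R * (-(ρ ^ 2)⁻¹))
    (fun ρ hρ => ((hasDerivAt_inv hρ.1.ne').const_mul R).hasDerivWithinAt)
    (fun a ha b hb h => by
      have := ha.1.ne'
      have := hb.1.ne'
      simp only at h
      field_simp at h
      exact h.symm), ← lintegral_const_mul' _ _ ENNReal.ofReal_ne_top]
  refine setLIntegral_congr_fun measurableSet_Ioo fun ρ hρ => ?_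
  have hρ0 := hρ.1
  have hk : sphericalKernel d (s * p) R (R / ρ)
      = ENNReal.ofReal ((R / ρ) ^ (-((d : ℝ) + s * p))) * ENNReal.ofReal (hardyPhi d s p ρ) := by
    rw [ofReal_hardyPhi hd hsp ⟨hρ.1, hρ.2.trans_le hθ1⟩, sphericalKernel_comm d _ 1,
      ← sphericalKernel_mul d _ (by positivity) hρ0.le zero_le_one, mul_one,
      div_mul_cancel₀ _ hρ0.ne']
  rw [hk, mul_neg, abs_neg, abs_of_pos (by positivity)]
  have e : R * (ρ ^ 2)⁻¹ * (R / ρ) ^ (d - 1) * (R / ρ) ^ (-((d : ℝ) + s * p))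
      = R ^ (-(s * p)) * ρ ^ (s * p - 1) := by
    obtain ⟨k, rfl⟩ : ∃ k, d = k + 1 := ⟨d - 1, by omega⟩
    rw [show -(((k + 1 : ℕ) : ℝ) + s * p) = -(s * p) - ((k + 1 : ℕ) : ℝ) by ring,
      Real.rpow_sub (by positivity), Real.rpow_natCast, Nat.add_sub_cancel,
      Real.div_rpow hR.le hρ0.le, Real.rpow_neg hρ0.le, Real.rpow_sub_one hρ0.ne']
    have := Real.rpow_pos_of_pos hρ0 (s * p)
    rw [pow_succ (R / ρ)]
    field_simp
  calc _ = ENNReal.ofReal (R * (ρ ^ 2)⁻¹ * (R / ρ) ^ (d - 1) * (R / ρ) ^ (-((d : ℝ) + s * p)))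
        * g (R / ρ) * ENNReal.ofReal (hardyPhi d s p ρ) := by
        rw [ENNReal.ofReal_mul (p := R * (ρ ^ 2)⁻¹ * (R / ρ) ^ (d - 1)) (by positivity),
          ENNReal.ofReal_mul (p := R * (ρ ^ 2)⁻¹) (by positivity)]
        ring
    _ = _ := by
        rw [e, ENNReal.ofReal_mul (by positivity)]
        ring

lemma lintegral_ball_norm_rpow_lt_top {d : ℕ} (hd : 1 ≤ d) {a : ℝ} (ha : a < d) (r : ℝ) :
    ∫⁻ y in Metric.ball (0 : EuclideanSpace ℝ (Fin d)) r, ENNReal.ofReal (‖y‖ ^ (-a)) < ⊤ := by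
  have h : IntegrableOn (fun y : EuclideanSpace ℝ (Fin d) => ‖y‖ ^ (-a)) (Metric.ball 0 r) :=
    integrableOn_ball_of_norm_le_rpow (C := 1) (α := a) (by simpa using hd) (by simpa using ha)
      (.of_forall fun y => by
        rw [one_mul, Real.norm_of_nonneg (by positivity)])
      (Measurable.aestronglyMeasurable (by fun_prop))
  exact h.lintegral_lt_top

lemma exists_abs_one_sub_rpow_le (γ : ℝ) :
    ∃ L, 0 ≤ L ∧ ∀ r ∈ Icc (1 / 2 : ℝ) 1, |1 - r ^ γ| ≤ L * (1 - r) := by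
  obtain ⟨L, hL⟩ := isCompact_Icc.exists_bound_of_continuousOn (s := Icc (1 / 2 : ℝ) 1)
    (f := fun r => γ * r ^ (γ - 1)) (by
      refine continuousOn_const.mul fun x hx => ContinuousAt.continuousWithinAt ?_
      exact Real.continuousAt_rpow_const _ _ (Or.inl (by linarith [hx.1])))
  have hL0 : 0 ≤ L := (norm_nonneg _).trans (hL 1 (by norm_num))
  refine ⟨L, hL0, fun r hr => ?_⟩
  have h := (convex_Icc (1 / 2 : ℝ) 1).norm_image_sub_le_of_norm_hasDerivWithin_le
    (f := fun r : ℝ => r ^ γ) (f' := fun r => γ * r ^ (γ - 1)) (C := L)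
    (fun x hx => (Real.hasDerivAt_rpow_const (Or.inl (by linarith [hx.1]))).hasDerivWithinAt)
    hL hr (right_mem_Icc.2 (by norm_num))
  simpa [Real.norm_eq_abs, abs_of_nonneg (sub_nonneg.2 hr.2)] using h

lemma hardyIntegrand_nonneg (d : ℕ) (s p α β : ℝ) {r : ℝ} (hr : r ∈ Ioo (0 : ℝ) 1) :
    0 ≤ hardyIntegrand d s p α β r := by
  have := hardyPhi_nonneg d s p hr
  have := hr.1
  unfold hardyIntegrand
  positivity

lemma measurable_hardyIntegrand (d : ℕ) (s p α β : ℝ) :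
    Measurable (hardyIntegrand d s p α β) := by
  have := measurable_hardyPhi d s p
  unfold hardyIntegrand
  fun_prop

/-- The density, in the variable `y`, of which `hardyIntegrand` is the radial profile. -/
noncomputable def hardyProfile (d : ℕ) (s p α β r : ℝ) : ℝ :=
  r ^ (s * p - d) * (r ^ α + r ^ β) * |1 - r ^ (((d : ℝ) - α - β - s * p) / p)| ^ p

lemma hardyProfile_le_near_zero {d : ℕ} {s p α β : ℝ} (hp : 0 < p) {r : ℝ} (hr : 0 < r) :
    hardyProfile d s p α β r ≤ 2 ^ p * (r ^ (-(d - s * p - α)) + r ^ (-(d - s * p - β))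
      + r ^ (-α) + r ^ (-β)) := by
  unfold hardyProfile
  set γ := ((d : ℝ) - α - β - s * p) / p with hγ
  have hγp : γ * p = (d : ℝ) - α - β - s * p := by rw [hγ]; field_simp
  have hw : 0 < r ^ γ := by positivity
  have h1 : |1 - r ^ γ| ^ p ≤ 2 ^ p * (1 + r ^ ((d : ℝ) - α - β - s * p)) := by
    have h2 : |1 - r ^ γ| ≤ 2 * max 1 (r ^ γ) := by
      rw [abs_le]
      constructor <;> linarith [le_max_left 1 (r ^ γ), le_max_right 1 (r ^ γ)]
    calc _ ≤ (2 * max 1 (r ^ γ)) ^ p := Real.rpow_le_rpow (abs_nonneg _) h2 hp.le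
      _ = 2 ^ p * (max 1 (r ^ γ)) ^ p := Real.mul_rpow (by norm_num) (by positivity)
      _ ≤ _ := by
        gcongr
        rw [← hγp, Real.rpow_mul hr.le]
        rcases max_cases 1 (r ^ γ) with h | h <;> rw [h.1]
        · rw [Real.one_rpow]
          have : 0 < (r ^ γ) ^ p := by positivity
          linarith
        · linarith
  refine (mul_le_mul_of_nonneg_left h1 (by positivity)).trans (le_of_eq ?_)
  have e1 : r ^ (s * p - d) * r ^ α = r ^ (-(d - s * p - α)) := by
    rw [← Real.rpow_add hr]; congr 1; ring
  have e2 : r ^ (s * p - d) * r ^ β = r ^ (-(d - s * p - β)) := by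
    rw [← Real.rpow_add hr]; congr 1; ring
  have e3 : r ^ (-(d - s * p - α)) * r ^ ((d : ℝ) - α - β - s * p) = r ^ (-β) := by
    rw [← Real.rpow_add hr]; congr 1; ring
  have e4 : r ^ (-(d - s * p - β)) * r ^ ((d : ℝ) - α - β - s * p) = r ^ (-α) := by
    rw [← Real.rpow_add hr]; congr 1; ring
  rw [mul_add, e1, e2]
  linear_combination 2 ^ p * e3 + 2 ^ p * e4

lemma exists_hardyProfile_le_near_one (d : ℕ) (s α β : ℝ) {p : ℝ} (hp : 0 < p) :
    ∃ C, 0 ≤ C ∧ ∀ r ∈ Icc (1 / 2 : ℝ) 1, hardyProfile d s p α β r ≤ C * (1 - r) ^ p := by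
  obtain ⟨L, hL0, hL⟩ := exists_abs_one_sub_rpow_le (((d : ℝ) - α - β - s * p) / p)
  obtain ⟨C, hC⟩ := isCompact_Icc.exists_bound_of_continuousOn (s := Icc (1 / 2 : ℝ) 1)
    (f := fun r : ℝ => r ^ (s * p - d) * (r ^ α + r ^ β)) (by
      have h : ∀ a : ℝ, ContinuousOn (fun r : ℝ => r ^ a) (Icc (1 / 2 : ℝ) 1) := fun a x hx =>
        (Real.continuousAt_rpow_const _ _ (Or.inl (by linarith [hx.1]))).continuousWithinAt
      exact (h _).mul ((h _).add (h _)))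
  have hC0 : 0 ≤ C := (norm_nonneg _).trans (hC 1 (by norm_num))
  refine ⟨C * L ^ p, by positivity, fun r hr => ?_⟩
  unfold hardyProfile
  have h1 := (le_abs_self _).trans (hC r hr)
  have h2 : |1 - r ^ (((d : ℝ) - α - β - s * p) / p)| ^ p ≤ (L * (1 - r)) ^ p :=
    Real.rpow_le_rpow (abs_nonneg _) (hL r hr) hp.le
  rw [Real.mul_rpow hL0 (by linarith [hr.2])] at h2
  rw [mul_assoc C]
  exact mul_le_mul h1 h2 (by positivity) hC0

/-- Undoing polar coordinates turns the integral into one over the unit ball against |e - y|^(-d-sp)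
with |e| = 1, so no asymptotics of Φ at r = 1 are needed. For |y| ≥ 1/2 the profile is at most C(1 -
|y|)^p ≤ C|e - y|^p, leaving a singularity of order d + sp - p < d. For |y| < 1/2 the powers at the
origin have orders d - sp - α, d - sp - β, α, β, all below d. -/
lemma lintegral_hardyIntegrand_lt_top {d : ℕ} (hd : 1 ≤ d) {s p α β : ℝ}
    (hs : 0 < s ∧ s < 1) (hp : 0 < p)
    (hα : α ∈ Ioo (-(s * p)) (d : ℝ)) (hβ : β ∈ Ioo (-(s * p)) (d : ℝ)) :
    ∫⁻ r in Ioo (0 : ℝ) 1, ENNReal.ofReal (hardyIntegrand d s p α β r) < ⊤ := by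
  have hsp : 0 < s * p := mul_pos hs.1 hp
  have hsp' : s * p < p := by nlinarith [hs.2]
  obtain ⟨k, rfl⟩ : ∃ k, d = k + 1 := ⟨d - 1, by omega⟩
  set d := k + 1 with hdk
  let e : EuclideanSpace ℝ (Fin d) := EuclideanSpace.single 0 1
  have he : ‖e‖ = 1 := by simp [e]
  have he0 : e ≠ 0 := by rw [← norm_pos_iff, he]; exact one_pos
  have hpm : Measurable (hardyProfile d s p α β) := by unfold hardyProfile; fun_prop
  have h := lintegral_inner hd hsp (θ := 1) le_rfl
    (g := fun r => ENNReal.ofReal (hardyProfile d s p α β r)) (by fun_prop) he0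
  rw [he, Real.one_rpow, ENNReal.ofReal_one, one_mul, one_mul] at h
  have h2 : ∫⁻ r in Ioo (0 : ℝ) 1, ENNReal.ofReal (hardyIntegrand d s p α β r)
      = ∫⁻ ρ in Ioo (0 : ℝ) 1, ENNReal.ofReal (ρ ^ ((d : ℝ) - 1)) *
        ENNReal.ofReal (hardyProfile d s p α β (1 * ρ)) * ENNReal.ofReal (hardyPhi d s p ρ) := by
    -- The exponent sp - d in `hardyProfile` becomes sp - 1 after multiplication by the Jacobian
    -- r^(d-1).
    refine setLIntegral_congr_fun measurableSet_Ioo fun r hr => ?_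
    have hr0 := hr.1
    simp only [one_mul]
    have hpn : 0 ≤ hardyProfile d s p α β r := by unfold hardyProfile; positivity
    rw [← ENNReal.ofReal_mul (by positivity), ← ENNReal.ofReal_mul (by positivity)]
    congr 1
    unfold hardyProfile hardyIntegrand
    rw [← mul_assoc, ← mul_assoc, ← Real.rpow_add hr0]
    congr 4
    ring
  rw [h2, ← h]
  obtain ⟨C, hC0, hC⟩ := exists_hardyProfile_le_near_one d s α β hp
  have hbound : ∀ y : EuclideanSpace ℝ (Fin d), y ≠ 0 →
      (Iio 1).indicator (fun r => ENNReal.ofReal (hardyProfile d s p α β r)) ‖y‖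
        * ENNReal.ofReal (‖e - y‖ ^ (-((d : ℝ) + s * p)))
      ≤ ENNReal.ofReal ((1 / 2 : ℝ) ^ (-((d : ℝ) + s * p)) * 2 ^ p) *
        (Metric.ball 0 1).indicator (fun y => ENNReal.ofReal (‖y‖ ^ (-(d - s * p - α)))
          + ENNReal.ofReal (‖y‖ ^ (-(d - s * p - β))) + ENNReal.ofReal (‖y‖ ^ (-α))
          + ENNReal.ofReal (‖y‖ ^ (-β))) y
        + ENNReal.ofReal C * (Metric.ball 0 2).indicator
          (fun z => ENNReal.ofReal (‖z‖ ^ (-((d : ℝ) + s * p - p)))) (e - y) := by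
    intro y hy
    have hy0 : 0 < ‖y‖ := norm_pos_iff.2 hy
    by_cases hy1 : ‖y‖ < 1
    · have hpn : 0 ≤ hardyProfile d s p α β ‖y‖ := by unfold hardyProfile; positivity
      rw [indicator_of_mem (by simpa using hy1), indicator_of_mem (by simpa using hy1),
        indicator_of_mem (by
          rw [mem_ball_zero_iff]
          linarith [norm_sub_le e y]), ← ENNReal.ofReal_mul hpn]
      have hey : 1 - ‖y‖ ≤ ‖e - y‖ := by
        have := norm_sub_norm_le e y
        rwa [he] at this
      have hey0 : 0 < ‖e - y‖ := by linarith
      rw [← ENNReal.ofReal_add (by positivity) (by positivity),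
        ← ENNReal.ofReal_add (by positivity) (by positivity),
        ← ENNReal.ofReal_add (by positivity) (by positivity),
        ← ENNReal.ofReal_mul (by positivity), ← ENNReal.ofReal_mul hC0]
      rcases le_or_gt (1 / 2) ‖y‖ with hh | hh
      · refine le_add_left (ENNReal.ofReal_le_ofReal ?_)
        have h1 : (1 - ‖y‖) ^ p ≤ ‖e - y‖ ^ p := Real.rpow_le_rpow (by linarith) hey hp.le
        calc _ ≤ C * (1 - ‖y‖) ^ p * ‖e - y‖ ^ (-((d : ℝ) + s * p)) := by
              gcongr
              exact hC _ ⟨hh, hy1.le⟩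
          _ ≤ C * ‖e - y‖ ^ p * ‖e - y‖ ^ (-((d : ℝ) + s * p)) := by gcongr
          _ = _ := by
            rw [mul_assoc, ← Real.rpow_add hey0]
            congr 2
            ring
      · refine le_add_right (ENNReal.ofReal_le_ofReal ?_)
        have h1 : ‖e - y‖ ^ (-((d : ℝ) + s * p)) ≤ (1 / 2 : ℝ) ^ (-((d : ℝ) + s * p)) :=
          Real.rpow_le_rpow_of_nonpos (by norm_num) (by linarith) (by
            have : (0 : ℝ) ≤ d := by positivity
            linarith)
        rw [mul_comm, mul_assoc]
        exact mul_le_mul h1 (hardyProfile_le_near_zero hp hy0) hpn (by positivity)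
    · rw [indicator_of_notMem (by simpa using hy1), zero_mul]
      exact zero_le
  have hnt : Nontrivial (EuclideanSpace ℝ (Fin d)) := ⟨e, 0, he0⟩
  refine lt_of_le_of_lt (lintegral_mono_ae ((Measure.ae_ne volume 0).mono hbound)) ?_
  rw [lintegral_add_right _ (by
    refine Measurable.const_mul ?_ _
    exact (Measurable.indicator (by fun_prop) measurableSet_ball).comp
      (measurable_const.sub measurable_id)), lintegral_const_mul' _ _ ENNReal.ofReal_ne_top,
    lintegral_const_mul' _ _ ENNReal.ofReal_ne_top, lintegral_indicator measurableSet_ball,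
    lintegral_sub_left_eq_self (fun z => (Metric.ball (0 : EuclideanSpace ℝ (Fin d)) 2).indicator
      (fun z => ENNReal.ofReal (‖z‖ ^ (-((d : ℝ) + s * p - p)))) z) e,
    lintegral_indicator measurableSet_ball,
    lintegral_add_right _ (by fun_prop), lintegral_add_right _ (by fun_prop),
    lintegral_add_right _ (by fun_prop)]
  have hf : ∀ {a : ℝ} (r : ℝ), a < d →
      ∫⁻ y in Metric.ball (0 : EuclideanSpace ℝ (Fin d)) r, ENNReal.ofReal (‖y‖ ^ (-a)) < ⊤ :=
    fun r ha => lintegral_ball_norm_rpow_lt_top hd ha r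
  refine ENNReal.add_lt_top.2 ⟨ENNReal.mul_lt_top ENNReal.ofReal_lt_top ?_,
    ENNReal.mul_lt_top ENNReal.ofReal_lt_top (hf 2 (by linarith))⟩
  refine ENNReal.add_lt_top.2 ⟨ENNReal.add_lt_top.2 ⟨ENNReal.add_lt_top.2 ⟨hf 1 ?_, hf 1 ?_⟩,
    hf 1 hα.2⟩, hf 1 hβ.2⟩
  · linarith [hα.1]
  · linarith [hβ.1]

lemma integrableOn_hardyIntegrand {d : ℕ} (hd : 1 ≤ d) {s p α β : ℝ}
    (hs : 0 < s ∧ s < 1) (hp : 0 < p)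
    (hα : α ∈ Ioo (-(s * p)) (d : ℝ)) (hβ : β ∈ Ioo (-(s * p)) (d : ℝ)) :
    IntegrableOn (hardyIntegrand d s p α β) (Ioo 0 1) := by
  refine ⟨(measurable_hardyIntegrand d s p α β).aestronglyMeasurable, ?_⟩
  rw [hasFiniteIntegral_iff_ofReal ((ae_restrict_mem measurableSet_Ioo).mono fun r hr =>
    hardyIntegrand_nonneg d s p α β hr)]
  exact lintegral_hardyIntegrand_lt_top hd hs hp hα hβ

end Coefficients

/-! ### Coefficients of the two linear terms on the cut region. -/

section GroundState

open ENNReal Filter Topology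

lemma tendsto_setLIntegral_iUnion {Ω : Type*} [MeasurableSpace Ω] {μ : Measure Ω} {S : ℕ → Set Ω}
    (hS : Monotone S) (f : Ω → ℝ≥0∞) :
    Tendsto (fun n => ∫⁻ x in S n, f x ∂μ) atTop (𝓝 (∫⁻ x in ⋃ n, S n, f x ∂μ)) := by
  rw [setLIntegral_iUnion_of_directed f hS.directed_le]
  exact tendsto_atTop_iSup fun m n h => lintegral_mono_set (hS h)

/-- Radial weight of the linear terms in the ground state inequality. -/
noncomputable def crossWeight (p α β γ R r : ℝ) : ℝ :=
  |R ^ (-γ) - r ^ (-γ)| ^ (p - 1) * (R ^ (-α) * r ^ (-β) + r ^ (-α) * R ^ (-β))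

lemma crossWeight_comm (p α β γ R r : ℝ) :
    crossWeight p α β γ R r = crossWeight p α β γ r R := by
  unfold crossWeight
  rw [abs_sub_comm, add_comm]

lemma crossWeight_nonneg (p α β γ : ℝ) {R r : ℝ} (hR : 0 ≤ R) (hr : 0 ≤ r) :
    0 ≤ crossWeight p α β γ R r := by
  unfold crossWeight
  positivity

lemma measurable_crossWeight {Ω : Type*} [MeasurableSpace Ω] (p α β γ : ℝ) {f g : Ω → ℝ}
    (hf : Measurable f) (hg : Measurable g) :
    Measurable fun x => crossWeight p α β γ (f x) (g x) := by
  unfold crossWeight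
  fun_prop

/-- Like `hardyIntegrand`, with the power `p - 1` in place of `p`. -/
noncomputable def crossProfile (d : ℕ) (s p α β γ r : ℝ) : ℝ :=
  r ^ (s * p - 1) * (r ^ α + r ^ β) * |1 - r ^ γ| ^ (p - 1) * hardyPhi d s p r

lemma crossProfile_nonneg (d : ℕ) (s p α β γ : ℝ) {r : ℝ} (hr : r ∈ Ioo (0 : ℝ) 1) :
    0 ≤ crossProfile d s p α β γ r := by
  have := hardyPhi_nonneg d s p hr
  have := hr.1
  unfold crossProfile
  positivity

lemma hardyIntegrand_eq {d : ℕ} {s p α β γ : ℝ} (hp : 2 ≤ p)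
    (hγ : ((d : ℝ) - α - β - s * p) / p = γ) (r : ℝ) :
    hardyIntegrand d s p α β r = |1 - r ^ γ| * crossProfile d s p α β γ r := by
  unfold hardyIntegrand crossProfile
  have : |1 - r ^ γ| ^ p = |1 - r ^ γ| ^ (p - 1) * |1 - r ^ γ| := by
    nth_rewrite 3 [← Real.rpow_one |1 - r ^ γ|]
    rw [← Real.rpow_add' (abs_nonneg _) (by linarith)]
    congr 1
    ring
  rw [hγ, this]
  ring

/-- The coefficient of the linear term integrated over the smaller of the two points. -/
noncomputable def innerCoeff (d : ℕ) (s p α β γ θ : ℝ) : ℝ≥0∞ :=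
  ∫⁻ ρ in Ioo 0 θ, ENNReal.ofReal (ρ ^ γ * crossProfile d s p α β γ ρ)

/-- The coefficient of the linear term integrated over the larger of the two points. -/
noncomputable def outerCoeff (d : ℕ) (s p α β γ θ : ℝ) : ℝ≥0∞ :=
  ∫⁻ ρ in Ioo 0 θ, ENNReal.ofReal (crossProfile d s p α β γ ρ)

/-- The integral defining `hardyConst`, restricted to `(0, θ)`. -/
noncomputable def cutHardyConst (d : ℕ) (s p α β θ : ℝ) : ℝ≥0∞ :=
  ∫⁻ ρ in Ioo 0 θ, ENNReal.ofReal (hardyIntegrand d s p α β ρ)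

section

variable {d : ℕ} {s p α β γ θ : ℝ}

lemma lintegral_inner_crossWeight (hd : 1 ≤ d) (hsp : 0 < s * p) (hp : 2 ≤ p)
    (hγ : ((d : ℝ) - α - β - s * p) / p = γ) (hθ1 : θ ≤ 1)
    {x : EuclideanSpace ℝ (Fin d)} (hx : x ≠ 0) :
    ∫⁻ y, (Iio (θ * ‖x‖)).indicator (fun r => ENNReal.ofReal (crossWeight p α β γ ‖x‖ r)) ‖y‖
        * ENNReal.ofReal (‖x - y‖ ^ (-((d : ℝ) + s * p)))
      = ENNReal.ofReal (‖x‖ ^ (-(γ * (p - 1) + α + β + s * p))) * innerCoeff d s p α β γ θ := by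
  have hR : 0 < ‖x‖ := norm_pos_iff.2 hx
  have hγp : (d : ℝ) - α - β - s * p = γ * p := by rw [← hγ]; field_simp
  rw [lintegral_inner hd hsp hθ1
    (g := fun r => ENNReal.ofReal (crossWeight p α β γ ‖x‖ r))
    (measurable_crossWeight p α β γ measurable_const measurable_id).ennreal_ofReal hx,
    show -(γ * (p - 1) + α + β + s * p) = -(s * p) + -(γ * (p - 1) + α + β) by ring,
    Real.rpow_add hR, ENNReal.ofReal_mul (by positivity), mul_assoc, innerCoeff,
    ← lintegral_const_mul' (ENNReal.ofReal (‖x‖ ^ (-(γ * (p - 1) + α + β)))) _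
      ENNReal.ofReal_ne_top]
  generalize ‖x‖ = R at *
  congr 1
  refine setLIntegral_congr_fun measurableSet_Ioo fun ρ hρ => ?_
  have hρ0 := hρ.1
  rw [← ENNReal.ofReal_mul (by positivity), ← ENNReal.ofReal_mul
    (mul_nonneg (by positivity) (crossWeight_nonneg _ _ _ _ hR.le (by positivity))),
    ← ENNReal.ofReal_mul (by positivity)]
  congr 1
  unfold crossWeight crossProfile
  have e1 : |R ^ (-γ) - (R * ρ) ^ (-γ)| ^ (p - 1)
      = R ^ (-(γ * (p - 1))) * (ρ ^ (-(γ * (p - 1))) * |1 - ρ ^ γ| ^ (p - 1)) := by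
    have : R ^ (-γ) - (R * ρ) ^ (-γ) = R ^ (-γ) * ρ ^ (-γ) * -(1 - ρ ^ γ) := by
      rw [Real.mul_rpow hR.le hρ0.le]
      have : ρ ^ (-γ) * ρ ^ γ = 1 := by rw [← Real.rpow_add hρ0, neg_add_cancel, Real.rpow_zero]
      linear_combination (-(R ^ (-γ))) * this
    rw [this, abs_mul, abs_neg, abs_of_pos (by positivity),
      Real.mul_rpow (by positivity) (abs_nonneg _), Real.mul_rpow (by positivity) (by positivity),
      ← Real.rpow_mul hR.le, ← Real.rpow_mul hρ0.le, neg_mul, mul_assoc]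
  have e2 : R ^ (-(γ * (p - 1) + α + β)) = R ^ (-(γ * (p - 1))) * R ^ (-α) * R ^ (-β) := by
    rw [← Real.rpow_add hR, ← Real.rpow_add hR]
    congr 1
    ring
  -- The choice of γ enters here through d = γp + α + β + sp. It also interchanges the roles of α
  -- and β, harmlessly because the weight is symmetrized.
  have e3 : ρ ^ ((d : ℝ) - 1) * ρ ^ (-(γ * (p - 1))) * ρ ^ (-β) = ρ ^ γ * ρ ^ (s * p - 1) * ρ ^ α := by
    simp only [← Real.rpow_add hρ0]
    congr 1
    linarith
  have e4 : ρ ^ ((d : ℝ) - 1) * ρ ^ (-(γ * (p - 1))) * ρ ^ (-α) = ρ ^ γ * ρ ^ (s * p - 1) * ρ ^ β := by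
    simp only [← Real.rpow_add hρ0]
    congr 1
    linarith
  rw [e1, e2, Real.mul_rpow hR.le hρ0.le, Real.mul_rpow hR.le hρ0.le]
  linear_combination (R ^ (-(γ * (p - 1))) * R ^ (-α) * R ^ (-β) * |1 - ρ ^ γ| ^ (p - 1)
    * hardyPhi d s p ρ) * (e3 + e4)

lemma lintegral_outer_crossWeight (hd : 1 ≤ d) (hsp : 0 < s * p) (hθ0 : 0 < θ) (hθ1 : θ ≤ 1)
    {x : EuclideanSpace ℝ (Fin d)} (hx : x ≠ 0) :
    ∫⁻ y, {r | ‖x‖ < θ * r}.indicator (fun r => ENNReal.ofReal (crossWeight p α β γ ‖x‖ r)) ‖y‖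
        * ENNReal.ofReal (‖x - y‖ ^ (-((d : ℝ) + s * p)))
      = ENNReal.ofReal (‖x‖ ^ (-(γ * (p - 1) + α + β + s * p))) * outerCoeff d s p α β γ θ := by
  have hR : 0 < ‖x‖ := norm_pos_iff.2 hx
  rw [lintegral_outer hd hsp hθ0 hθ1
    (g := fun r => ENNReal.ofReal (crossWeight p α β γ ‖x‖ r))
    (measurable_crossWeight p α β γ measurable_const measurable_id).ennreal_ofReal hx,
    show -(γ * (p - 1) + α + β + s * p) = -(s * p) + -(γ * (p - 1) + α + β) by ring,
    Real.rpow_add hR, ENNReal.ofReal_mul (by positivity), mul_assoc, outerCoeff,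
    ← lintegral_const_mul' (ENNReal.ofReal (‖x‖ ^ (-(γ * (p - 1) + α + β)))) _
      ENNReal.ofReal_ne_top]
  generalize ‖x‖ = R at *
  congr 1
  refine setLIntegral_congr_fun measurableSet_Ioo fun ρ hρ => ?_
  have hρ0 := hρ.1
  rw [← ENNReal.ofReal_mul (by positivity), ← ENNReal.ofReal_mul
    (mul_nonneg (by positivity) (crossWeight_nonneg _ _ _ _ hR.le (by positivity))),
    ← ENNReal.ofReal_mul (by positivity)]
  congr 1
  unfold crossWeight crossProfile
  have e0 : ∀ a : ℝ, (R / ρ) ^ (-a) = R ^ (-a) * ρ ^ a := fun a => by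
    rw [Real.div_rpow hR.le hρ0.le, Real.rpow_neg hρ0.le, div_inv_eq_mul]
  have e1 : |R ^ (-γ) - (R / ρ) ^ (-γ)| ^ (p - 1)
      = R ^ (-(γ * (p - 1))) * |1 - ρ ^ γ| ^ (p - 1) := by
    rw [e0, show R ^ (-γ) - R ^ (-γ) * ρ ^ γ = R ^ (-γ) * (1 - ρ ^ γ) by ring, abs_mul,
      abs_of_pos (by positivity), Real.mul_rpow (by positivity) (abs_nonneg _),
      ← Real.rpow_mul hR.le, neg_mul]
  have e2 : R ^ (-(γ * (p - 1) + α + β)) = R ^ (-(γ * (p - 1))) * R ^ (-α) * R ^ (-β) := by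
    rw [← Real.rpow_add hR, ← Real.rpow_add hR]
    congr 1
    ring
  rw [e1, e2, e0, e0]
  ring

/-- The relation between the coefficients of the two linear terms. -/
lemma outerCoeff_eq (hp : 2 ≤ p) (hγ : ((d : ℝ) - α - β - s * p) / p = γ) (hγ0 : 0 < γ)
    (hθ1 : θ ≤ 1) :
    outerCoeff d s p α β γ θ = innerCoeff d s p α β γ θ + cutHardyConst d s p α β θ := by
  unfold outerCoeff innerCoeff cutHardyConst
  rw [← lintegral_add_right _ (measurable_hardyIntegrand d s p α β).ennreal_ofReal]
  refine setLIntegral_congr_fun measurableSet_Ioo fun ρ hρ => ?_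
  have hρ' : ρ ∈ Ioo (0 : ℝ) 1 := ⟨hρ.1, hρ.2.trans_le hθ1⟩
  have h0 := hρ.1
  rw [← ENNReal.ofReal_add (mul_nonneg (by positivity) (crossProfile_nonneg _ _ _ _ _ _ hρ'))
    (hardyIntegrand_nonneg _ _ _ _ _ hρ'), hardyIntegrand_eq hp hγ,
    abs_of_nonneg (sub_nonneg.2 (Real.rpow_le_one hρ.1.le hρ'.2.le hγ0.le))]
  congr 1
  ring

/-- The two integrands differ by (1 - ρ^γ) times the cross profile. For γ < 0 this factor is
negative on (0, 1), so the inner coefficient is now the larger one. -/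
lemma innerCoeff_eq (hp : 2 ≤ p) (hγ : ((d : ℝ) - α - β - s * p) / p = γ) (hγ0 : γ < 0)
    (hθ1 : θ ≤ 1) :
    innerCoeff d s p α β γ θ = outerCoeff d s p α β γ θ + cutHardyConst d s p α β θ := by
  unfold outerCoeff innerCoeff cutHardyConst
  rw [← lintegral_add_right _ (measurable_hardyIntegrand d s p α β).ennreal_ofReal]
  refine setLIntegral_congr_fun measurableSet_Ioo fun ρ hρ => ?_
  have hρ' : ρ ∈ Ioo (0 : ℝ) 1 := ⟨hρ.1, hρ.2.trans_le hθ1⟩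
  rw [← ENNReal.ofReal_add (crossProfile_nonneg _ _ _ _ _ _ hρ')
    (hardyIntegrand_nonneg _ _ _ _ _ hρ'), hardyIntegrand_eq hp hγ,
    abs_of_nonpos (sub_nonpos.2 (Real.one_le_rpow_of_pos_of_le_one_of_nonpos hρ.1 hρ'.2.le hγ0.le))]
  congr 1
  ring

lemma cutHardyConst_lt_top (hd : 1 ≤ d) (hs : 0 < s ∧ s < 1) (hp : 0 < p)
    (hα : α ∈ Ioo (-(s * p)) (d : ℝ)) (hβ : β ∈ Ioo (-(s * p)) (d : ℝ)) (hθ1 : θ ≤ 1) :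
    cutHardyConst d s p α β θ < ⊤ :=
  (lintegral_mono_set (Ioo_subset_Ioo_right hθ1)).trans_lt
    (lintegral_hardyIntegrand_lt_top hd hs hp hα hβ)

/-- Below θ < 1 one has ρ^γ ≤ 1 and 1 - ρ^γ ≥ 1 - θ^γ > 0, so the integrand is at most
`hardyIntegrand` divided by 1 - θ^γ. This bound degenerates as θ → 1, which is why the cut is
needed. -/
lemma innerCoeff_ne_top (hp : 2 ≤ p) (hγ : ((d : ℝ) - α - β - s * p) / p = γ) (hγ0 : 0 < γ)
    (hθ0 : 0 < θ) (hθ1 : θ < 1) (h : cutHardyConst d s p α β θ < ⊤) :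
    innerCoeff d s p α β γ θ ≠ ⊤ := by
  have hδ : 0 < 1 - θ ^ γ := sub_pos.2 (Real.rpow_lt_one hθ0.le hθ1 hγ0)
  refine ne_top_of_le_ne_top (ENNReal.mul_lt_top (ENNReal.ofReal_lt_top (r := (1 - θ ^ γ)⁻¹)) h).ne ?_
  rw [cutHardyConst, ← lintegral_const_mul' _ _ ENNReal.ofReal_ne_top]
  refine setLIntegral_mono' measurableSet_Ioo fun ρ hρ => ?_
  have hρ' : ρ ∈ Ioo (0 : ℝ) 1 := ⟨hρ.1, hρ.2.trans hθ1⟩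
  have h0 := crossProfile_nonneg d s p α β γ hρ'
  have h1 : ρ ^ γ ≤ θ ^ γ := Real.rpow_le_rpow hρ.1.le hρ.2.le hγ0.le
  rw [← ENNReal.ofReal_mul (by positivity), hardyIntegrand_eq hp hγ,
    abs_of_nonneg (by linarith : 0 ≤ 1 - ρ ^ γ), ← mul_assoc]
  refine ENNReal.ofReal_le_ofReal (mul_le_mul_of_nonneg_right ?_ h0)
  rw [inv_mul_eq_div]
  exact (Real.rpow_le_one hρ.1.le hρ'.2.le hγ0.le).trans ((one_le_div hδ).2 (by linarith))

lemma outerCoeff_ne_top (hp : 2 ≤ p) (hγ : ((d : ℝ) - α - β - s * p) / p = γ) (hγ0 : γ < 0)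
    (hθ0 : 0 < θ) (hθ1 : θ < 1) (h : cutHardyConst d s p α β θ < ⊤) :
    outerCoeff d s p α β γ θ ≠ ⊤ := by
  have hδ : 0 < θ ^ γ - 1 := sub_pos.2 (Real.one_lt_rpow_of_pos_of_lt_one_of_neg hθ0 hθ1 hγ0)
  refine ne_top_of_le_ne_top (ENNReal.mul_lt_top (ENNReal.ofReal_lt_top (r := (θ ^ γ - 1)⁻¹)) h).ne ?_
  rw [cutHardyConst, ← lintegral_const_mul' _ _ ENNReal.ofReal_ne_top]
  refine setLIntegral_mono' measurableSet_Ioo fun ρ hρ => ?_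
  have hρ' : ρ ∈ Ioo (0 : ℝ) 1 := ⟨hρ.1, hρ.2.trans hθ1⟩
  have h0 := crossProfile_nonneg d s p α β γ hρ'
  have h1 : θ ^ γ ≤ ρ ^ γ := Real.rpow_le_rpow_of_nonpos hρ.1 hρ.2.le hγ0.le
  rw [← ENNReal.ofReal_mul (by positivity), hardyIntegrand_eq hp hγ,
    abs_of_nonpos (by linarith : 1 - ρ ^ γ ≤ 0), ← mul_assoc]
  refine ENNReal.ofReal_le_ofReal (le_mul_of_one_le_left h0 ?_)
  rw [inv_mul_eq_div]
  exact (one_le_div hδ).2 (by linarith)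

end

end GroundState

/-! ### Reduction to ordered pairs, and monotone limits of the cuts. -/

section Symmetrization

open ENNReal Filter Topology

/-- Pairs of points for which the second one is smaller than the first one by a factor `θ`. -/
def cutSet (d : ℕ) (θ : ℝ) : Set (EuclideanSpace ℝ (Fin d) × EuclideanSpace ℝ (Fin d)) :=
  {q | ‖q.2‖ < θ * ‖q.1‖}

lemma measurableSet_cutSet (d : ℕ) (θ : ℝ) : MeasurableSet (cutSet d θ) :=
  measurableSet_lt (by fun_prop) (by fun_prop)

/-- Pairs with equal norms form a null set because spheres are null; the swap carries one of the two
remaining regions onto the other. -/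
lemma lintegral_eq_lintegral_cutSet_one {d : ℕ} (hd : 1 ≤ d)
    {F : EuclideanSpace ℝ (Fin d) × EuclideanSpace ℝ (Fin d) → ℝ≥0∞} (hF : Measurable F) :
    ∫⁻ q, F q = ∫⁻ q in cutSet d 1, (F q + F q.swap) := by
  have : Nonempty (Fin d) := ⟨⟨0, hd⟩⟩
  have hnull : (volume : Measure (EuclideanSpace ℝ (Fin d) × EuclideanSpace ℝ (Fin d)))
      {q | ‖q.2‖ = ‖q.1‖} = 0 := by
    rw [Measure.volume_eq_prod, Measure.measure_prod_null
      (measurableSet_eq_fun (by fun_prop) (by fun_prop))]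
    refine .of_forall fun x => ?_
    have : Prod.mk x ⁻¹' {q : EuclideanSpace ℝ (Fin d) × EuclideanSpace ℝ (Fin d) | ‖q.2‖ = ‖q.1‖}
        = Metric.sphere 0 ‖x‖ := by
      ext y
      simp
    simp only [this, Pi.zero_apply]
    exact Measure.addHaar_sphere _ _ _
  have hswap : ∫⁻ q in cutSet d 1, F q.swap = ∫⁻ q in Prod.swap ⁻¹' cutSet d 1, F q := by
    have h := (Measure.measurePreserving_swap (μ := (volume : Measure (EuclideanSpace ℝ (Fin d))))
      (ν := (volume : Measure (EuclideanSpace ℝ (Fin d))))).setLIntegral_comp_preimage_emb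
      MeasurableEquiv.prodComm.measurableEmbedding F (Prod.swap ⁻¹' cutSet d 1)
    rw [Measure.volume_eq_prod, ← h]
    rfl
  rw [lintegral_add_left hF, hswap,
    ← lintegral_union (measurable_swap (measurableSet_cutSet d 1))]
  · rw [← setLIntegral_univ]
    refine setLIntegral_congr (ae_eq_set.2 ⟨measure_mono_null (fun q hq => ?_) hnull, by simp⟩)
    simp only [cutSet, one_mul, Set.mem_sdiff, mem_univ, mem_union, mem_preimage, mem_ofPred_eq,
      Prod.snd_swap, Prod.fst_swap, true_and, not_or, not_lt] at hq ⊢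
    exact le_antisymm hq.2 hq.1
  · refine disjoint_left.2 fun q h1 h2 => ?_
    simp only [cutSet, one_mul, mem_preimage, mem_ofPred_eq, Prod.snd_swap, Prod.fst_swap] at h1 h2
    exact lt_asymm h1 h2

lemma monotone_cutSet (d : ℕ) {θ : ℕ → ℝ} (hθ : Monotone θ) : Monotone fun n => cutSet d (θ n) :=
  fun _ _ h _ hq => lt_of_lt_of_le (b := _) hq
    (mul_le_mul_of_nonneg_right (hθ h) (norm_nonneg _))

lemma iUnion_cutSet (d : ℕ) {θ : ℕ → ℝ} (h1 : ∀ n, θ n < 1) (hlim : Tendsto θ atTop (𝓝 1)) :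
    ⋃ n, cutSet d (θ n) = cutSet d 1 := by
  ext q
  simp only [mem_iUnion, cutSet, mem_ofPred_eq]
  constructor
  · rintro ⟨n, hn⟩
    exact hn.trans_le (mul_le_mul_of_nonneg_right (h1 n).le (norm_nonneg _))
  · intro h
    exact ((hlim.mul_const ‖q.1‖).eventually_const_lt h).exists

lemma tendsto_lintegral_cutSet {d : ℕ} (hd : 1 ≤ d) {θ : ℕ → ℝ} (hθ : Monotone θ)
    (h1 : ∀ n, θ n < 1) (hlim : Tendsto θ atTop (𝓝 1))
    {F : EuclideanSpace ℝ (Fin d) × EuclideanSpace ℝ (Fin d) → ℝ≥0∞} (hF : Measurable F) :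
    Tendsto (fun n => ∫⁻ q in cutSet d (θ n), (F q + F q.swap)) atTop (𝓝 (∫⁻ q, F q)) := by
  have h := tendsto_setLIntegral_iUnion (μ := volume) (monotone_cutSet d hθ)
    (fun q => F q + F q.swap)
  rwa [iUnion_cutSet d h1 hlim, ← lintegral_eq_lintegral_cutSet_one hd hF] at h

lemma tendsto_cutHardyConst {d : ℕ} (hd : 1 ≤ d) {s p α β : ℝ} (hs : 0 < s ∧ s < 1) (hp : 0 < p)
    (hα : α ∈ Ioo (-(s * p)) (d : ℝ)) (hβ : β ∈ Ioo (-(s * p)) (d : ℝ)) {θ : ℕ → ℝ}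
    (hθ : Monotone θ) (h1 : ∀ n, θ n < 1) (hlim : Tendsto θ atTop (𝓝 1)) :
    Tendsto (fun n => cutHardyConst d s p α β (θ n)) atTop
      (𝓝 (ENNReal.ofReal (hardyConst d s p α β))) := by
  have h := tendsto_setLIntegral_iUnion (μ := volume) (S := fun n => Ioo (0 : ℝ) (θ n))
    (fun _ _ h => Ioo_subset_Ioo_right (hθ h))
    (fun ρ => ENNReal.ofReal (hardyIntegrand d s p α β ρ))
  have hU : ⋃ n, Ioo (0 : ℝ) (θ n) = Ioo 0 1 := by
    ext ρ
    simp only [mem_iUnion, mem_Ioo]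
    constructor
    · rintro ⟨n, hn⟩
      exact ⟨hn.1, hn.2.trans (h1 n)⟩
    · intro h
      obtain ⟨n, hn⟩ := (hlim.eventually_const_lt h.2).exists
      exact ⟨n, h.1, hn⟩
  rw [hU, ← ofReal_integral_eq_lintegral_ofReal (integrableOn_hardyIntegrand hd hs hp hα hβ)
    ((ae_restrict_mem measurableSet_Ioo).mono fun r hr => hardyIntegrand_nonneg d s p α β hr)] at h
  exact h

end Symmetrization

/-! ### The pointwise inequality in terms of the densities. -/

section Main

open ENNReal Filter Topology

variable {𝕜 : Type*} [RCLike 𝕜] {d : ℕ} {s p α β γ θ : ℝ}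

/-- The integrand of `weightedGagliardo`, as a function of the pair of points. -/
noncomputable def gagliardoDensity (d : ℕ) (s p a b : ℝ) (f : EuclideanSpace ℝ (Fin d) → 𝕜)
    (q : EuclideanSpace ℝ (Fin d) × EuclideanSpace ℝ (Fin d)) : ℝ≥0∞ :=
  ENNReal.ofReal (‖f q.1 - f q.2‖ ^ p / ‖q.1 - q.2‖ ^ ((d : ℝ) + s * p) * ‖q.1‖ ^ (-a)
    * ‖q.2‖ ^ (-b))

lemma measurable_gagliardoDensity (s p a b : ℝ) {f : EuclideanSpace ℝ (Fin d) → 𝕜}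
    (hf : Measurable f) : Measurable (gagliardoDensity d s p a b f) := by
  unfold gagliardoDensity
  fun_prop

lemma weightedGagliardo_eq (s p a b : ℝ) {f : EuclideanSpace ℝ (Fin d) → 𝕜} (hf : Measurable f) :
    weightedGagliardo d s p a b f = ∫⁻ q, gagliardoDensity d s p a b f q := by
  rw [Measure.volume_eq_prod,
    lintegral_prod _ (measurable_gagliardoDensity s p a b hf).aemeasurable]
  rfl

lemma gagliardoDensity_add_swap (s p a b : ℝ) (f : EuclideanSpace ℝ (Fin d) → 𝕜)
    (q : EuclideanSpace ℝ (Fin d) × EuclideanSpace ℝ (Fin d)) :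
    gagliardoDensity d s p a b f q + gagliardoDensity d s p a b f q.swap
      = ENNReal.ofReal (‖f q.1 - f q.2‖ ^ p * ((‖q.1‖ ^ (-a) * ‖q.2‖ ^ (-b)
        + ‖q.2‖ ^ (-a) * ‖q.1‖ ^ (-b)) * ‖q.1 - q.2‖ ^ (-((d : ℝ) + s * p)))) := by
  unfold gagliardoDensity
  rw [← ENNReal.ofReal_add (by positivity) (by positivity), Prod.fst_swap, Prod.snd_swap,
    norm_sub_rev (f q.2), norm_sub_rev q.2, Real.rpow_neg (norm_nonneg (q.1 - q.2))]
  congr 1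
  ring

lemma measurable_groundStateQuotient (s p α β : ℝ) {u : EuclideanSpace ℝ (Fin d) → 𝕜}
    (hu : Measurable u) : Measurable (groundStateQuotient d s p α β u) := by
  unfold groundStateQuotient
  exact Measurable.smul (by fun_prop) hu

lemma rpow_neg_smul_groundStateQuotient (hγ : ((d : ℝ) - α - β - s * p) / p = γ)
    (u : EuclideanSpace ℝ (Fin d) → 𝕜) {x : EuclideanSpace ℝ (Fin d)} (hx : x ≠ 0) :
    ‖x‖ ^ (-γ) • groundStateQuotient d s p α β u x = u x := by
  have hR : 0 < ‖x‖ := norm_pos_iff.2 hx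
  rw [groundStateQuotient, hγ, smul_smul, ← Real.rpow_add hR, neg_add_cancel, Real.rpow_zero,
    one_smul]

/-- The factor depending on one point in the linear terms. -/
noncomputable def crossMass (d : ℕ) (s p α β γ : ℝ) (u : EuclideanSpace ℝ (Fin d) → 𝕜)
    (x : EuclideanSpace ℝ (Fin d)) : ℝ :=
  ‖x‖ ^ (-γ) * ‖groundStateQuotient d s p α β u x‖ ^ p

lemma crossMass_nonneg (s p α β γ : ℝ) (u : EuclideanSpace ℝ (Fin d) → 𝕜)
    (x : EuclideanSpace ℝ (Fin d)) : 0 ≤ crossMass d s p α β γ u x := by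
  unfold crossMass
  positivity

lemma measurable_crossMass (s p α β γ : ℝ) {u : EuclideanSpace ℝ (Fin d) → 𝕜}
    (hu : Measurable u) : Measurable (crossMass d s p α β γ u) := by
  have := measurable_groundStateQuotient s p α β hu
  unfold crossMass
  fun_prop

lemma crossMass_mul_rpow (hγ : ((d : ℝ) - α - β - s * p) / p = γ)
    (u : EuclideanSpace ℝ (Fin d) → 𝕜) {x : EuclideanSpace ℝ (Fin d)} (hx : x ≠ 0) :
    ENNReal.ofReal (crossMass d s p α β γ u x)
        * ENNReal.ofReal (‖x‖ ^ (-(γ * (p - 1) + α + β + s * p)))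
      = ENNReal.ofReal (‖u x‖ ^ p / ‖x‖ ^ (s * p + α + β)) := by
  have hR : 0 < ‖x‖ := norm_pos_iff.2 hx
  rw [← ENNReal.ofReal_mul (crossMass_nonneg ..), crossMass, groundStateQuotient, hγ, norm_smul,
    Real.norm_of_nonneg (by positivity), Real.mul_rpow (by positivity) (norm_nonneg _),
    ← Real.rpow_mul hR.le, div_eq_mul_inv, ← Real.rpow_neg hR.le]
  have : ‖x‖ ^ (-(s * p + α + β))
      = ‖x‖ ^ (-γ) * ‖x‖ ^ (γ * p) * ‖x‖ ^ (-(γ * (p - 1) + α + β + s * p)) := by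
    rw [← Real.rpow_add hR, ← Real.rpow_add hR]
    congr 1
    ring
  rw [this]
  congr 1
  ring

/-- The integrand of the linear terms, without the factor `crossMass`. -/
noncomputable def crossDensity (d : ℕ) (s p α β γ : ℝ)
    (q : EuclideanSpace ℝ (Fin d) × EuclideanSpace ℝ (Fin d)) : ℝ≥0∞ :=
  ENNReal.ofReal (crossWeight p α β γ ‖q.1‖ ‖q.2‖)
    * ENNReal.ofReal (‖q.1 - q.2‖ ^ (-((d : ℝ) + s * p)))

lemma measurable_crossDensity (d : ℕ) (s p α β γ : ℝ) :
    Measurable (crossDensity d s p α β γ) :=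
  (measurable_crossWeight p α β γ (by fun_prop) (by fun_prop)).ennreal_ofReal.mul (by fun_prop)

lemma ae_ne_zero (hd : 1 ≤ d) : ∀ᵐ x : EuclideanSpace ℝ (Fin d), x ≠ 0 := by
  have : Nonempty (Fin d) := ⟨⟨0, hd⟩⟩
  exact Measure.ae_ne volume 0

lemma lintegral_crossDensity_fst (hd : 1 ≤ d) (hsp : 0 < s * p) (hp : 2 ≤ p)
    (hγ : ((d : ℝ) - α - β - s * p) / p = γ) (hθ1 : θ ≤ 1)
    {u : EuclideanSpace ℝ (Fin d) → 𝕜} (hu : Measurable u) :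
    ∫⁻ q in cutSet d θ, crossDensity d s p α β γ q * ENNReal.ofReal (crossMass d s p α β γ u q.1)
      = innerCoeff d s p α β γ θ * hardyTerm d p (s * p + α + β) u := by
  have hm : Measurable fun q => crossDensity d s p α β γ q
      * ENNReal.ofReal (crossMass d s p α β γ u q.1) := (measurable_crossDensity d s p α β γ).mul
    ((measurable_crossMass s p α β γ hu).comp measurable_fst).ennreal_ofReal
  rw [← lintegral_indicator (measurableSet_cutSet d θ), Measure.volume_eq_prod]
  refine (lintegral_prod _ (hm.indicator (measurableSet_cutSet d θ)).aemeasurable).trans ?_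
  rw [hardyTerm,
    ← lintegral_const_mul _ (by fun_prop)]
  refine lintegral_congr_ae ((ae_ne_zero hd).mono fun x hx => ?_)
  simp only
  rw [← crossMass_mul_rpow hγ u hx, mul_left_comm,
    mul_comm (innerCoeff d s p α β γ θ),
    ← lintegral_inner_crossWeight hd hsp hp hγ hθ1 hx, ← lintegral_const_mul' _ _
      ENNReal.ofReal_ne_top]
  refine lintegral_congr fun y => ?_
  by_cases h : ‖y‖ < θ * ‖x‖
  · rw [indicator_of_mem (show (x, y) ∈ cutSet d θ from h), indicator_of_mem (by exact h),
      crossDensity, mul_comm]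
  · rw [indicator_of_notMem (show (x, y) ∉ cutSet d θ from h), indicator_of_notMem (by exact h)]
    simp

/-- The mass sits at the smaller point, so Tonelli is applied in the opposite order: the larger
point is integrated first, over the exterior of a ball. -/
lemma lintegral_crossDensity_snd (hd : 1 ≤ d) (hsp : 0 < s * p)
    (hγ : ((d : ℝ) - α - β - s * p) / p = γ) (hθ0 : 0 < θ) (hθ1 : θ ≤ 1)
    {u : EuclideanSpace ℝ (Fin d) → 𝕜} (hu : Measurable u) :
    ∫⁻ q in cutSet d θ, crossDensity d s p α β γ q * ENNReal.ofReal (crossMass d s p α β γ u q.2)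
      = outerCoeff d s p α β γ θ * hardyTerm d p (s * p + α + β) u := by
  have hm : Measurable fun q => crossDensity d s p α β γ q
      * ENNReal.ofReal (crossMass d s p α β γ u q.2) := (measurable_crossDensity d s p α β γ).mul
    ((measurable_crossMass s p α β γ hu).comp measurable_snd).ennreal_ofReal
  rw [← lintegral_indicator (measurableSet_cutSet d θ), Measure.volume_eq_prod]
  refine (lintegral_prod_symm _ (hm.indicator (measurableSet_cutSet d θ)).aemeasurable).trans ?_
  rw [hardyTerm,
    ← lintegral_const_mul _ (by fun_prop)]
  refine lintegral_congr_ae ((ae_ne_zero hd).mono fun x hx => ?_)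
  simp only
  rw [← crossMass_mul_rpow hγ u hx, mul_left_comm,
    mul_comm (outerCoeff d s p α β γ θ),
    ← lintegral_outer_crossWeight hd hsp hθ0 hθ1 hx, ← lintegral_const_mul' _ _
      ENNReal.ofReal_ne_top]
  refine lintegral_congr fun y => ?_
  by_cases h : ‖x‖ < θ * ‖y‖
  · rw [indicator_of_mem (show (y, x) ∈ cutSet d θ from h), indicator_of_mem (by exact h),
      crossDensity, mul_comm, crossWeight_comm, norm_sub_rev]
  · rw [indicator_of_notMem (show (y, x) ∉ cutSet d θ from h), indicator_of_notMem (by exact h)]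
    simp

/-- The integrand of the remainder term, symmetrized. -/
lemma gagliardoDensity_groundStateQuotient_add_swap
    (hγ : ((d : ℝ) - α - β - s * p) / p = γ) (hp : 2 ≤ p) (u : EuclideanSpace ℝ (Fin d) → 𝕜)
    {q : EuclideanSpace ℝ (Fin d) × EuclideanSpace ℝ (Fin d)} (h1 : q.1 ≠ 0) (h2 : q.2 ≠ 0) :
    gagliardoDensity d s p ((d + α - β - s * p) / 2) ((d - α + β - s * p) / 2)
        (groundStateQuotient d s p α β u) q
      + gagliardoDensity d s p ((d + α - β - s * p) / 2) ((d - α + β - s * p) / 2)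
        (groundStateQuotient d s p α β u) q.swap
      = ENNReal.ofReal ((‖q.1‖ ^ (-γ) * ‖q.2‖ ^ (-γ)) ^ (p / 2)
        * ‖groundStateQuotient d s p α β u q.1 - groundStateQuotient d s p α β u q.2‖ ^ p
        * ((‖q.1‖ ^ (-α) * ‖q.2‖ ^ (-β)
          + ‖q.2‖ ^ (-α) * ‖q.1‖ ^ (-β)) * ‖q.1 - q.2‖ ^ (-((d : ℝ) + s * p)))) := by
  have hγp : (d : ℝ) - α - β - s * p = γ * p := by rw [← hγ]; field_simp
  have hx : 0 < ‖q.1‖ := norm_pos_iff.2 h1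
  have hy : 0 < ‖q.2‖ := norm_pos_iff.2 h2
  rw [gagliardoDensity_add_swap, Real.mul_rpow (by positivity) (by positivity),
    ← Real.rpow_mul hx.le, ← Real.rpow_mul hy.le,
    -- The factor (w₁w₂)^(p/2) shifts both exponents α and β by γp/2, which yields the weights of
    -- the remainder term.
    show -((d + α - β - s * p) / 2) = -γ * (p / 2) + -α by linarith,
    show -((d - α + β - s * p) / 2) = -γ * (p / 2) + -β by linarith,
    Real.rpow_add hx, Real.rpow_add hx, Real.rpow_add hy, Real.rpow_add hy]
  congr 1
  ring

lemma cross_term_eq (s p α β γ : ℝ) (u : EuclideanSpace ℝ (Fin d) → 𝕜)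
    (q : EuclideanSpace ℝ (Fin d) × EuclideanSpace ℝ (Fin d)) (z : EuclideanSpace ℝ (Fin d)) :
    crossDensity d s p α β γ q * ENNReal.ofReal (crossMass d s p α β γ u z)
      = ENNReal.ofReal (|‖q.1‖ ^ (-γ) - ‖q.2‖ ^ (-γ)| ^ (p - 1) * crossMass d s p α β γ u z
        * ((‖q.1‖ ^ (-α) * ‖q.2‖ ^ (-β)
          + ‖q.2‖ ^ (-α) * ‖q.1‖ ^ (-β)) * ‖q.1 - q.2‖ ^ (-((d : ℝ) + s * p)))) := by
  rw [crossDensity, ← ENNReal.ofReal_mul (crossWeight_nonneg _ _ _ _ (norm_nonneg _) (norm_nonneg _)),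
    ← ENNReal.ofReal_mul (mul_nonneg (crossWeight_nonneg _ _ _ _ (norm_nonneg _) (norm_nonneg _))
      (by positivity)), crossWeight]
  congr 1
  ring

/-- The pointwise inequality between the integrands. -/
lemma pointwise_le (hγ : ((d : ℝ) - α - β - s * p) / p = γ) (hp : 2 ≤ p)
    (u : EuclideanSpace ℝ (Fin d) → 𝕜)
    {q : EuclideanSpace ℝ (Fin d) × EuclideanSpace ℝ (Fin d)} (h1 : q.1 ≠ 0) (h2 : q.2 ≠ 0)
    (h : ‖q.2‖ ^ (-γ) < ‖q.1‖ ^ (-γ)) :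
    crossDensity d s p α β γ q * ENNReal.ofReal (crossMass d s p α β γ u q.1)
      + ENNReal.ofReal (remainderConst p) *
        (gagliardoDensity d s p ((d + α - β - s * p) / 2) ((d - α + β - s * p) / 2)
          (groundStateQuotient d s p α β u) q
        + gagliardoDensity d s p ((d + α - β - s * p) / 2) ((d - α + β - s * p) / 2)
          (groundStateQuotient d s p α β u) q.swap)
      ≤ (gagliardoDensity d s p α β u q + gagliardoDensity d s p α β u q.swap)
        + crossDensity d s p α β γ q * ENNReal.ofReal (crossMass d s p α β γ u q.2) := by
  have hy : 0 < ‖q.2‖ ^ (-γ) := Real.rpow_pos_of_pos (norm_pos_iff.2 h2) _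
  have hg := ground_state_le hp hy h (groundStateQuotient d s p α β u q.1)
    (groundStateQuotient d s p α β u q.2)
  rw [rpow_neg_smul_groundStateQuotient hγ u h1, rpow_neg_smul_groundStateQuotient hγ u h2] at hg
  have hc := remainderConst_nonneg hp
  have hm1 := crossMass_nonneg s p α β γ u q.1
  have hm2 := crossMass_nonneg s p α β γ u q.2
  rw [gagliardoDensity_groundStateQuotient_add_swap hγ hp u h1 h2, gagliardoDensity_add_swap,
    cross_term_eq, cross_term_eq, ← ENNReal.ofReal_mul hc,
    ← ENNReal.ofReal_add (by positivity) (by positivity),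
    ← ENNReal.ofReal_add (by positivity) (by positivity), abs_of_pos (sub_pos.2 h)]
  refine ENNReal.ofReal_le_ofReal ?_
  rw [← add_mul, ← mul_assoc (remainderConst p), ← add_mul]
  exact mul_le_mul_of_nonneg_right hg (by positivity)

lemma pointwise_eq (hγ : ((d : ℝ) - α - β - s * 2) / 2 = γ)
    (u : EuclideanSpace ℝ (Fin d) → 𝕜)
    {q : EuclideanSpace ℝ (Fin d) × EuclideanSpace ℝ (Fin d)} (h1 : q.1 ≠ 0) (h2 : q.2 ≠ 0)
    (h : ‖q.2‖ ^ (-γ) < ‖q.1‖ ^ (-γ)) :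
    crossDensity d s 2 α β γ q * ENNReal.ofReal (crossMass d s 2 α β γ u q.1)
      + ENNReal.ofReal (remainderConst 2) *
        (gagliardoDensity d s 2 ((d + α - β - s * 2) / 2) ((d - α + β - s * 2) / 2)
          (groundStateQuotient d s 2 α β u) q
        + gagliardoDensity d s 2 ((d + α - β - s * 2) / 2) ((d - α + β - s * 2) / 2)
          (groundStateQuotient d s 2 α β u) q.swap)
      = (gagliardoDensity d s 2 α β u q + gagliardoDensity d s 2 α β u q.swap)
        + crossDensity d s 2 α β γ q * ENNReal.ofReal (crossMass d s 2 α β γ u q.2) := by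
  have hg := ground_state_eq (w₁ := ‖q.1‖ ^ (-γ)) (w₂ := ‖q.2‖ ^ (-γ))
    (groundStateQuotient d s 2 α β u q.1) (groundStateQuotient d s 2 α β u q.2)
  rw [rpow_neg_smul_groundStateQuotient hγ u h1, rpow_neg_smul_groundStateQuotient hγ u h2] at hg
  have hm1 := crossMass_nonneg s 2 α β γ u q.1
  have hm2 := crossMass_nonneg s 2 α β γ u q.2
  rw [gagliardoDensity_groundStateQuotient_add_swap hγ le_rfl u h1 h2, gagliardoDensity_add_swap,
    cross_term_eq, cross_term_eq, remainderConst_two, ENNReal.ofReal_one, one_mul,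
    ← ENNReal.ofReal_add (by positivity) (by positivity),
    ← ENNReal.ofReal_add (by positivity) (by positivity), abs_of_pos (sub_pos.2 h)]
  congr 1
  rw [← add_mul, ← add_mul]
  congr 1
  simp only [crossMass, Real.rpow_two, div_self (two_ne_zero' ℝ), Real.rpow_one,
    show (2 : ℝ) - 1 = 1 by norm_num]
  exact hg

end Main

/-! ### Cancellation of the linear terms, finiteness of the Hardy term, and the limit. -/

section Conclusion

open ENNReal Filter Topology

/-- Only the common part aH must be finite: the linear terms are kept on opposite sides to avoid
subtraction in [0, ∞], and the energy of U may be infinite. -/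
lemma setLIntegral_cancel_le {Ω : Type*} [MeasurableSpace Ω] {μ : Measure Ω} {S : Set Ω}
    {P Q U R : Ω → ℝ≥0∞} (hP : Measurable P) (hU : Measurable U) {a C H c : ℝ≥0∞} (hc : c ≠ ⊤)
    (hIP : ∫⁻ q in S, P q ∂μ = (a + C) * H) (hIQ : ∫⁻ q in S, Q q ∂μ = a * H) (hfin : a * H ≠ ⊤)
    (h : ∀ᵐ q ∂μ.restrict S, P q + c * R q ≤ U q + Q q) :
    C * H + c * ∫⁻ q in S, R q ∂μ ≤ ∫⁻ q in S, U q ∂μ := by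
  have h1 := lintegral_mono_ae h
  rw [lintegral_add_left hP, lintegral_add_left hU, lintegral_const_mul' _ _ hc, hIP, hIQ,
    add_mul, add_assoc, add_comm] at h1
  exact (ENNReal.add_le_add_iff_right hfin).1 h1

lemma setLIntegral_cancel_eq {Ω : Type*} [MeasurableSpace Ω] {μ : Measure Ω} {S : Set Ω}
    {P Q U R : Ω → ℝ≥0∞} (hP : Measurable P) (hU : Measurable U) {a C H c : ℝ≥0∞} (hc : c ≠ ⊤)
    (hIP : ∫⁻ q in S, P q ∂μ = (a + C) * H) (hIQ : ∫⁻ q in S, Q q ∂μ = a * H) (hfin : a * H ≠ ⊤)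
    (h : ∀ᵐ q ∂μ.restrict S, P q + c * R q = U q + Q q) :
    C * H + c * ∫⁻ q in S, R q ∂μ = ∫⁻ q in S, U q ∂μ := by
  have h1 := lintegral_congr_ae h
  rw [lintegral_add_left hP, lintegral_add_left hU, lintegral_const_mul' _ _ hc, hIP, hIQ,
    add_mul, add_assoc, add_comm] at h1
  exact (ENNReal.add_left_inj hfin).1 h1

variable {𝕜 : Type*} [RCLike 𝕜] {d : ℕ} {s p α β γ θ : ℝ}

lemma crossDensity_swap (d : ℕ) (s p α β γ : ℝ)
    (q : EuclideanSpace ℝ (Fin d) × EuclideanSpace ℝ (Fin d)) :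
    crossDensity d s p α β γ q.swap = crossDensity d s p α β γ q := by
  rw [crossDensity, crossDensity, Prod.fst_swap, Prod.snd_swap, crossWeight_comm, norm_sub_rev]

lemma ae_cutSet (hd : 1 ≤ d) (hθ1 : θ < 1) :
    ∀ᵐ q ∂(volume : Measure (EuclideanSpace ℝ (Fin d) × EuclideanSpace ℝ (Fin d))).restrict
      (cutSet d θ), q.1 ≠ 0 ∧ q.2 ≠ 0 ∧ ‖q.2‖ < ‖q.1‖ := by
  have h2 : ∀ᵐ q : EuclideanSpace ℝ (Fin d) × EuclideanSpace ℝ (Fin d), q.2 ≠ 0 :=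
    Measure.quasiMeasurePreserving_snd.ae (ae_ne_zero hd)
  filter_upwards [ae_restrict_of_ae h2, ae_restrict_mem (measurableSet_cutSet d θ)] with q hq hc
  have hlt : ‖q.2‖ < ‖q.1‖ := lt_of_lt_of_le hc (mul_le_of_le_one_left (norm_nonneg _) hθ1.le)
  exact ⟨norm_pos_iff.1 ((norm_nonneg _).trans_lt hlt), hq, hlt⟩

/-- The ground state inequality for the energies restricted to `cutSet d θ`. -/
lemma cut_inequality (hd : 1 ≤ d) (hs : 0 < s ∧ s < 1) (hp : 2 ≤ p)
    (hα : α ∈ Ioo (-(s * p)) (d : ℝ)) (hβ : β ∈ Ioo (-(s * p)) (d : ℝ))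
    (hγ : ((d : ℝ) - α - β - s * p) / p = γ) (hγ0 : γ ≠ 0) (hθ0 : 0 < θ) (hθ1 : θ < 1)
    {u : EuclideanSpace ℝ (Fin d) → 𝕜} (hu : Measurable u)
    (hH : hardyTerm d p (s * p + α + β) u < ⊤) :
    let L := cutHardyConst d s p α β θ * hardyTerm d p (s * p + α + β) u
      + ENNReal.ofReal (remainderConst p) * ∫⁻ q in cutSet d θ,
        (gagliardoDensity d s p ((d + α - β - s * p) / 2) ((d - α + β - s * p) / 2)
            (groundStateQuotient d s p α β u) q
          + gagliardoDensity d s p ((d + α - β - s * p) / 2) ((d - α + β - s * p) / 2)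
            (groundStateQuotient d s p α β u) q.swap)
    let R := ∫⁻ q in cutSet d θ,
      (gagliardoDensity d s p α β u q + gagliardoDensity d s p α β u q.swap)
    L ≤ R ∧ (p = 2 → L = R) := by
  have hp0 : 0 < p := by linarith
  have hsp : 0 < s * p := mul_pos hs.1 hp0
  have hC := cutHardyConst_lt_top hd hs hp0 hα hβ hθ1.le
  have hm := measurable_gagliardoDensity s p α β hu
  have hU : Measurable fun q => gagliardoDensity d s p α β u q
    + gagliardoDensity d s p α β u q.swap := hm.add (hm.comp measurable_swap)
  have hM1 := (measurable_crossDensity d s p α β γ).mul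
    ((measurable_crossMass s p α β γ hu).comp measurable_fst).ennreal_ofReal
  have hM2 := (measurable_crossDensity d s p α β γ).mul
    ((measurable_crossMass s p α β γ hu).comp measurable_snd).ennreal_ofReal
  have h1 := lintegral_crossDensity_fst hd hsp hp hγ hθ1.le hu
  have h2 := lintegral_crossDensity_snd hd hsp hγ hθ0 hθ1.le hu
  -- The pointwise inequality requires the larger weight first. For γ < 0 that is the point of
  -- larger norm, `q.1`; for γ > 0 it is `q.2`, so the inequality is applied to the swapped pair.
  rcases hγ0.lt_or_gt with hneg | hpos
  · have hfin := ENNReal.mul_ne_top (outerCoeff_ne_top hp hγ hneg hθ0 hθ1 hC) hH.ne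
    rw [innerCoeff_eq hp hγ hneg hθ1.le] at h1
    have hw : ∀ᵐ q ∂(volume : Measure (EuclideanSpace ℝ (Fin d) × EuclideanSpace ℝ (Fin d))).restrict
        (cutSet d θ), q.1 ≠ 0 ∧ q.2 ≠ 0 ∧ ‖q.2‖ ^ (-γ) < ‖q.1‖ ^ (-γ) := by
      filter_upwards [ae_cutSet hd hθ1] with q hq
      exact ⟨hq.1, hq.2.1, Real.rpow_lt_rpow (norm_nonneg _) hq.2.2 (by linarith)⟩
    refine ⟨setLIntegral_cancel_le hM1 hU ENNReal.ofReal_ne_top h1 h2 hfin ?_, ?_⟩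
    · filter_upwards [hw] with q hq
      exact pointwise_le hγ hp u hq.1 hq.2.1 hq.2.2
    · rintro rfl
      refine setLIntegral_cancel_eq hM1 hU ENNReal.ofReal_ne_top h1 h2 hfin ?_
      filter_upwards [hw] with q hq
      exact pointwise_eq hγ u hq.1 hq.2.1 hq.2.2
  · have hfin := ENNReal.mul_ne_top (innerCoeff_ne_top hp hγ hpos hθ0 hθ1 hC) hH.ne
    rw [outerCoeff_eq hp hγ hpos hθ1.le] at h2
    have hw : ∀ᵐ q ∂(volume : Measure (EuclideanSpace ℝ (Fin d) × EuclideanSpace ℝ (Fin d))).restrict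
        (cutSet d θ), q.1 ≠ 0 ∧ q.2 ≠ 0 ∧ ‖q.1‖ ^ (-γ) < ‖q.2‖ ^ (-γ) := by
      filter_upwards [ae_cutSet hd hθ1] with q hq
      exact ⟨hq.1, hq.2.1, Real.rpow_lt_rpow_of_neg (norm_pos_iff.2 hq.2.1) hq.2.2 (by linarith)⟩
    refine ⟨setLIntegral_cancel_le hM2 hU ENNReal.ofReal_ne_top h2 h1 hfin ?_, ?_⟩
    · filter_upwards [hw] with q hq
      have h := pointwise_le hγ hp u (q := q.swap) hq.2.1 hq.1 hq.2.2
      rw [crossDensity_swap, Prod.swap_swap, Prod.fst_swap, Prod.snd_swap,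
        add_comm (gagliardoDensity d s p α β u q.swap),
        add_comm (gagliardoDensity _ _ _ _ _ _ q.swap)] at h
      exact h
    · rintro rfl
      refine setLIntegral_cancel_eq hM2 hU ENNReal.ofReal_ne_top h2 h1 hfin ?_
      filter_upwards [hw] with q hq
      have h := pointwise_eq hγ u (q := q.swap) hq.2.1 hq.1 hq.2.2
      rw [crossDensity_swap, Prod.swap_swap, Prod.fst_swap, Prod.snd_swap,
        add_comm (gagliardoDensity d s 2 α β u q.swap),
        add_comm (gagliardoDensity _ _ _ _ _ _ q.swap)] at h
      exact h

lemma hardyTerm_lt_top_of_le (hd : 1 ≤ d) (hp : 0 < p) {a a₀ C : ℝ} (ha₀ : a₀ < d) (hC : 0 ≤ C)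
    {u : EuclideanSpace ℝ (Fin d) → 𝕜} (hu : HasCompactSupport u)
    (h : ∀ x, ‖u x‖ ^ p / ‖x‖ ^ a ≤ C * ‖x‖ ^ (-a₀)) :
    hardyTerm d p a u < ⊤ := by
  obtain ⟨r, hr⟩ := hu.isBounded.subset_ball (0 : EuclideanSpace ℝ (Fin d))
  calc hardyTerm d p a u ≤ ∫⁻ x in Metric.ball (0 : EuclideanSpace ℝ (Fin d)) r,
        ENNReal.ofReal C * ENNReal.ofReal (‖x‖ ^ (-a₀)) := by
        rw [hardyTerm, ← lintegral_indicator measurableSet_ball]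
        refine lintegral_mono fun x => ?_
        by_cases hx : x ∈ Metric.ball (0 : EuclideanSpace ℝ (Fin d)) r
        · rw [indicator_of_mem hx, ← ENNReal.ofReal_mul hC]
          exact ENNReal.ofReal_le_ofReal (h x)
        · have : u x = 0 := by
            by_contra h0
            exact hx (hr (subset_tsupport u h0))
          rw [this, norm_zero, Real.zero_rpow hp.ne', zero_div, ENNReal.ofReal_zero]
          exact zero_le
    _ < ⊤ := by
        rw [lintegral_const_mul' _ _ ENNReal.ofReal_ne_top]
        exact ENNReal.mul_lt_top ENNReal.ofReal_lt_top (lintegral_ball_norm_rpow_lt_top hd ha₀ r)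

/-- For a < d the singularity at the origin is locally integrable and u is bounded. For a > d the
function vanishes near the origin, so the integrand is bounded on a bounded set. -/
lemma hardyTerm_lt_top (hd : 1 ≤ d) (hp : 0 < p) {a : ℝ} {u : EuclideanSpace ℝ (Fin d) → 𝕜}
    (huc : Continuous u) (hu : HasCompactSupport u)
    (h : a < d ∨ ((d : ℝ) < a ∧ (0 : EuclideanSpace ℝ (Fin d)) ∉ tsupport u)) :
    hardyTerm d p a u < ⊤ := by
  obtain ⟨M, hM⟩ := hu.exists_bound_of_continuous huc
  have hM0 : 0 ≤ M := (norm_nonneg _).trans (hM 0)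
  have hMp : ∀ x, ‖u x‖ ^ p ≤ M ^ p := fun x => Real.rpow_le_rpow (norm_nonneg _) (hM x) hp.le
  have hd0 : (0 : ℝ) < d := by exact_mod_cast hd
  rcases h with ha | ⟨ha, h0⟩
  · refine hardyTerm_lt_top_of_le hd hp ha (C := M ^ p) (by positivity) hu fun x => ?_
    rw [Real.rpow_neg (norm_nonneg _), div_eq_mul_inv]
    exact mul_le_mul_of_nonneg_right (hMp x) (by positivity)
  · obtain ⟨ε, hε, hball⟩ := Metric.isOpen_iff.1 (isClosed_tsupport u).isOpen_compl 0 h0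
    refine hardyTerm_lt_top_of_le hd hp hd0 (C := M ^ p / ε ^ a) (by positivity) hu fun x => ?_
    rw [neg_zero, Real.rpow_zero, mul_one]
    by_cases hx : ‖x‖ < ε
    · have : u x = 0 := by
        by_contra hne
        exact hball (mem_ball_zero_iff.2 hx) (subset_tsupport u hne)
      rw [this, norm_zero, Real.zero_rpow hp.ne', zero_div]
      positivity
    · exact div_le_div₀ (by positivity) (hMp x) (by positivity)
        (Real.rpow_le_rpow hε.le (not_lt.1 hx) (by linarith))

end Conclusion

theorem theorem1p6 {𝕜 : Type*} [RCLike 𝕜] (d : ℕ) (hd : 1 ≤ d) (s p α β : ℝ)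
    (hs : 0 < s ∧ s < 1) (hp : 2 ≤ p)
    (hα : α ∈ Set.Ioo (-(s * p)) (d : ℝ)) (hβ : β ∈ Set.Ioo (-(s * p)) (d : ℝ))
    (hαβ : α + β ∈ Set.Ioo (-(s * p)) (d : ℝ)) :
    -- the constants are well defined: the integral converges and the minimum is attained
    IntegrableOn (hardyIntegrand d s p α β) (Set.Ioo 0 1) ∧
    IsLeast (remainderValues p) (remainderConst p) ∧
    (p = 2 → remainderConst p = 1) ∧
    ∀ u : EuclideanSpace ℝ (Fin d) → 𝕜, Continuous u → HasCompactSupport u →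
      (s * p + α + β < d ∨ (d < s * p + α + β ∧ (0 : EuclideanSpace ℝ (Fin d)) ∉ tsupport u)) →
      -- the subtracted Hardy term is finite, so that it may be moved to the right-hand side
      hardyTerm d p (s * p + α + β) u < ⊤ ∧
      ENNReal.ofReal (hardyConst d s p α β) * hardyTerm d p (s * p + α + β) u +
          ENNReal.ofReal (remainderConst p) *
            weightedGagliardo d s p ((d + α - β - s * p) / 2) ((d - α + β - s * p) / 2)
              (groundStateQuotient d s p α β u)
        ≤ weightedGagliardo d s p α β u ∧
      (p = 2 →
        weightedGagliardo d s p α β u =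
          ENNReal.ofReal (hardyConst d s p α β) * hardyTerm d p (s * p + α + β) u +
            weightedGagliardo d s p ((d + α - β - s * p) / 2) ((d - α + β - s * p) / 2)
              (groundStateQuotient d s p α β u)) := by
  have hp0 : 0 < p := by linarith
  refine ⟨integrableOn_hardyIntegrand hd hs hp0 hα hβ, isLeast_remainderConst hp,
    fun h => h ▸ remainderConst_two, fun u hu hsupp h => ?_⟩
  have hH := hardyTerm_lt_top hd hp0 hu hsupp h
  refine ⟨hH, ?_⟩
  -- The dichotomy on sp + α + β excludes γ = 0, for which w would be constant and the strict
  -- ordering of weights would fail.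
  have hγ0 : ((d : ℝ) - α - β - s * p) / p ≠ 0 := by
    refine div_ne_zero ?_ hp0.ne'
    rcases h with h | ⟨h, -⟩
    · exact ne_of_gt (by linarith)
    · exact ne_of_lt (by linarith)
  have hum : Measurable u := hu.measurable
  have hvm := measurable_groundStateQuotient s p α β hum
  -- The shift by 2 keeps θ positive already at n = 0, as the outer substitution requires.
  set θ : ℕ → ℝ := fun n => 1 - 1 / ((n : ℝ) + 2) with hθ
  have hθ0 : ∀ n, 0 < θ n := fun n => by
    simp only [hθ, sub_pos]
    rw [div_lt_one (by positivity)]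
    have : (0 : ℝ) ≤ n := by positivity
    linarith
  have hθ1 : ∀ n, θ n < 1 := fun n => by
    simp only [hθ]
    have : (0 : ℝ) < 1 / ((n : ℝ) + 2) := by positivity
    linarith
  have hmono : Monotone θ := fun m n hmn => by
    simp only [hθ]
    have : (m : ℝ) ≤ n := by exact_mod_cast hmn
    gcongr
  have hlim : Filter.Tendsto θ Filter.atTop (nhds 1) := by
    have h1 : Filter.Tendsto (fun n : ℕ => (n : ℝ) + 2) Filter.atTop Filter.atTop :=
      Filter.tendsto_atTop_add_const_right _ _ tendsto_natCast_atTop_atTop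
    have h2 := (tendsto_const_nhds (x := (1 : ℝ))).sub
      ((tendsto_const_nhds (x := (1 : ℝ))).div_atTop h1)
    rwa [sub_zero] at h2
  have hcut := fun n => cut_inequality hd hs hp hα hβ rfl hγ0 (hθ0 n) (hθ1 n) hum hH
  -- After the cancellation only quantities increasing with θ remain, so both sides converge in [0,
  -- ∞] even when the energies are infinite.
  have hL := (ENNReal.Tendsto.mul_const (tendsto_cutHardyConst hd hs hp0 hα hβ hmono hθ1 hlim)
      (Or.inr hH.ne)).add (ENNReal.Tendsto.const_mul (a := ENNReal.ofReal (remainderConst p))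
        (tendsto_lintegral_cutSet hd hmono hθ1 hlim
        (measurable_gagliardoDensity s p ((d + α - β - s * p) / 2) ((d - α + β - s * p) / 2) hvm))
      (Or.inr ENNReal.ofReal_ne_top))
  have hR := tendsto_lintegral_cutSet hd hmono hθ1 hlim
    (measurable_gagliardoDensity s p α β hum)
  rw [weightedGagliardo_eq s p α β hum, weightedGagliardo_eq s p _ _ hvm]
  refine ⟨le_of_tendsto_of_tendsto' hL hR fun n => (hcut n).1, fun h2 => ?_⟩
  have he := tendsto_nhds_unique hL (hR.congr fun n => ((hcut n).2 h2).symm)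
  have hc : remainderConst p = 1 := h2 ▸ remainderConst_two
  rw [hc, ENNReal.ofReal_one, one_mul] at he
  exact he.symm
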